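/- Let $\theta>0$ and $\ell\in\{1,2,\dots\}$. Let $W_1,W_2,\dots$ be i.i.d. with the beta$(1,\theta)$ distribution, and let $U_1,U_2,\dots$ be i.i.d. uniform on $[0,1]$, independent of $(W_i)$. Put $P_i=(1-W_1)\cdots(1-W_{i-1})W_i$, $R_0=0$, $R_k=P_1+\dots+P_k$ and $I_k=[R_{k-1},R_k)$. Let $Q^*_n(k)=\#\{1\le i\le n: U_i\ge R_k\}$ be the number of the first $n$ sample points outside the first $k$ intervals, and $n(k,m)=\min\{n: Q^*_n(k)=m\}$. Let $$C_k^{\ell,\theta}=\sum_{j=1}^k 1\{Q^*_{n(k,\ell)}(j)=Q^*_{n(k,\ell)}(j-1)\}$$ be the number of empty intervals among the first $k$ at time $n(k,\ell)$. Let $(\widehat Q_j)_{j\ge0}$ be a Markov chain on the positive integers with $\widehat Q_0=\ell$ and transition probabilities $$\widehat q(m,n)=\binom{n-1}{m-1}\mathbb E\big[W_1^{\,n-m}(1-W_1)^m\big]\quad(n\ge m),\qquad \widehat q(m,n)=0\quad(n<m),$$ and let $\widehat C_k^{\ell,\theta}=\sum_{j=1}^k 1\{\widehat Q_j=\widehat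 Q_{j-1}\}$. Then: 1. For every $k$, $C_k^{\ell,\theta}$ and $\widehat C_k^{\ell,\theta}$ have the same law. 2. Almost surely, $\widehat C_k^{\ell,\theta}$ increases to a finite limit $C_\infty^{\ell,\theta}$ as $k\to\infty$. For every real $p>0$, $\mathbb E[(C_\infty^{\ell,\theta})^p]<\infty$ and $$\lim_{k\to\infty}\mathbb E[(C_k^{\ell,\theta})^p]=\lim_{k\to\infty}\mathbb E[(\widehat C_k^{\ell,\theta})^p]=\mathbb E[(C_\infty^{\ell,\theta})^p].$$ 3. For every complex $z$ with $|z|<1+\ell/\theta$ (in particular for $|z|\le1$), $z^{C_\infty^{\ell,\theta}}$ is integrable and $$\mathbb E\, z^{C_\infty^{\ell,\theta}}=\frac{\Gamma(\ell+1+\theta)\,\Gamma(\ell+\theta-\theta z)}{\Gamma(\ell)\,\Gamma(\ell+1+2\theta-\theta z)}.$$ 4. $C_\infty^{\ell,\theta}$ has the mixed Poisson distribution with random parameter $-\theta\log H$, where $H$ has the beta$(\ell,\theta+1)$ distribution. 5. Let $u_k=\mathbb P\big(\text{for each } 1\le i\le k \text{ there is } 1\le j<n(k,1) \text{ with } U_j\in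 I_i\big)$. Then $$u_\infty:=\lim_{k\to\infty}u_k=\frac{\Gamma(\theta+2)\,\Gamma(\theta+1)}{\Gamma(2\theta+2)}.$$ -/

import Mathlib

open MeasureTheory ProbabilityTheory Filter Topology
open scoped NNReal ENNReal

namespace StickBreaking

section Sampling

variable {Ω : Type*}

/-- Length `P_{i+1} = (1 - W_1) ⋯ (1 - W_i) W_{i+1}` of the `(i+1)`-th interval. The factor
`W_{i+1}` is `W i`: the sequence is indexed from `0` in Lean. -/
noncomputable def stickLength (W : ℕ → Ω → ℝ) (i : ℕ) (ω : Ω) : ℝ :=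
  (∏ j ∈ Finset.range i, (1 - W j ω)) * W i ω

/-- Right end point `R_k = P_1 + ⋯ + P_k` of the `k`-th interval, with `R_0 = 0`. -/
noncomputable def endpoint (W : ℕ → Ω → ℝ) (k : ℕ) (ω : Ω) : ℝ :=
  ∑ i ∈ Finset.range k, stickLength W i ω

/-- The `(i+1)`-th interval `I_{i+1} = [R_i, R_{i+1})`. -/
def interval (W : ℕ → Ω → ℝ) (i : ℕ) (ω : Ω) : Set ℝ :=
  Set.Ico (endpoint W i ω) (endpoint W (i + 1) ω)

open Classical in
/-- `Q*_n(k)`: the number of those among the first `n` sample points `U_1, …, U_n` (in Lean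
`U 0, …, U (n - 1)`) that fall outside `[0, R_k)`, the union of the first `k` intervals. -/
noncomputable def outsideCount (W U : ℕ → Ω → ℝ) (n k : ℕ) (ω : Ω) : ℕ :=
  ((Finset.range n).filter fun i => endpoint W k ω ≤ U i ω).card

/-- `n(k, m) = min {n : Q*_n(k) = m}`: the first time at which `m` sample points are outside the
first `k` intervals. -/
noncomputable def hittingTime (W U : ℕ → Ω → ℝ) (k m : ℕ) (ω : Ω) : ℕ :=
  sInf {n : ℕ | outsideCount W U n k ω = m}

/-- `C_k^ℓ`: the number of indices `1 ≤ j ≤ k` with `Q*_{n(k,ℓ)}(j) = Q*_{n(k,ℓ)}(j-1)`, that is,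
the number of empty intervals among the first `k` at time `n(k, ℓ)`. -/
noncomputable def emptyCount (W U : ℕ → Ω → ℝ) (ℓ k : ℕ) (ω : Ω) : ℕ :=
  ((Finset.Icc 1 k).filter fun j =>
    outsideCount W U (hittingTime W U k ℓ ω) j ω
      = outsideCount W U (hittingTime W U k ℓ ω) (j - 1) ω).card

/-- `u_k`: the probability that each of the first `k` intervals contains one of the sample points
`U_j` with `1 ≤ j < n(k, 1)` (the point `U_j` is `U (j - 1)` in Lean). -/
noncomputable def renewalProb [MeasurableSpace Ω] (μ : Measure Ω) (W U : ℕ → Ω → ℝ) (k : ℕ) : ℝ :=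
  μ.real {ω | ∀ i < k, ∃ j, 1 ≤ j ∧ j < hittingTime W U k 1 ω ∧ U (j - 1) ω ∈ interval W i ω}

/-- The stick-breaking sampling model on `(Ω, μ)`: the factors `W_i` are i.i.d. with law `ν`, the
sample points `U_i` are i.i.d. uniform on `[0, 1]`, and the two sequences are independent. -/
structure IsModel [MeasurableSpace Ω] (ν : Measure ℝ) (μ : Measure Ω) (W U : ℕ → Ω → ℝ) :
    Prop where
  measurable_factor : ∀ i, Measurable (W i)
  measurable_point : ∀ i, Measurable (U i)
  law_factor : ∀ i, μ.map (W i) = ν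
  law_point : ∀ i, μ.map (U i) = (volume : Measure ℝ).restrict (Set.Icc 0 1)
  indep_factor : iIndepFun W μ
  indep_point : iIndepFun U μ
  indep : IndepFun (fun ω i => W i ω) (fun ω i => U i ω) μ

end Sampling

section Chain

variable {Ω : Type*}

/-- The transition probability function
`q̂(m, n) = binom(n-1, m-1) E[W^(n-m) (1-W)^m]` for `1 ≤ m ≤ n`, where `W` has law `ν`. The states
are the positive integers; the state `0` is never visited from a positive one. -/
noncomputable def transitionProb (ν : Measure ℝ) (m n : ℕ) : ℝ :=
  if m ≤ n then ((n - 1).choose (m - 1) : ℝ) * ∫ w, w ^ (n - m) * (1 - w) ^ m ∂ν else 0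

/-- `Q` is a (time-homogeneous) Markov chain on `(Ω, μ)` with transition function `q` started from
the state `ℓ`. -/
structure IsMarkovChainFrom [MeasurableSpace Ω] (q : ℕ → ℕ → ℝ) (ℓ : ℕ) (μ : Measure Ω)
    (Q : ℕ → Ω → ℕ) : Prop where
  measurable : ∀ j, Measurable (Q j)
  initial : ∀ᵐ ω ∂μ, Q 0 ω = ℓ
  step : ∀ (k : ℕ) (x : ℕ → ℕ),
    μ.real {ω | ∀ j ≤ k + 1, Q j ω = x j}
      = μ.real {ω | ∀ j ≤ k, Q j ω = x j} * q (x k) (x (k + 1))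

/-- `Ĉ_k`: the number of indices `1 ≤ j ≤ k` with `Q̂_j = Q̂_{j-1}`. -/
def stayCount (Q : ℕ → Ω → ℕ) (k : ℕ) (ω : Ω) : ℕ :=
  ((Finset.Icc 1 k).filter fun j => Q j ω = Q (j - 1) ω).card

end Chain

/-- The mixed Poisson law on `ℕ` whose random parameter has law `ρ`. -/
noncomputable def mixedPoisson (ρ : Measure ℝ≥0) : Measure ℕ :=
  ρ.bind poissonMeasure

/-- The Poisson laws depend measurably on the parameter, so that the mixture above is the
intended one. -/
theorem measurable_poisson : Measurable poissonMeasure := by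
  refine Measure.measurable_of_measurable_coe _ fun s _ => ?_
  have h : ∀ r : ℝ≥0, poissonMeasure r s
      = ∑' n : ℕ, s.indicator (fun n => poissonMeasure r {n}) n := fun r => by
    rw [Measure.tsum_indicator_apply_singleton _ _ (MeasurableSet.of_discrete)]
  simp_rw [h]
  refine Measurable.tsum fun n => ?_
  by_cases hn : n ∈ s
  · simp only [Set.indicator_of_mem hn, poissonMeasure_singleton]
    fun_prop
  · simp [Set.indicator_of_notMem hn]

end StickBreaking

open StickBreaking

/-! Freeze the sample at time `n(K, ℓ)` and read the counts backwards, removing the intervals `K, K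
- 1, …, 1` in turn. The resulting sequence `reversedCount` starts at `ℓ`, and its stays are the
empty intervals. It is the chain `Q̂` run up to time `K`. Indeed, a path ending at `n` prescribes
the counts at time `n` and requires the `n`-th point to lie beyond `R_K`. Given the `W_i`,
distributing the other points gives binomial coefficients times powers of the stick lengths
(`measureReal_counts`). After regrouping, each `W_i` appears in one factor only, and independence
turns the expectation into a product of transition probabilities
(`IsModel.measureReal_outsideCount`). Since a different sequence arises for each `K`, everything
about chains is proved on a finite horizon (`IsChainUpTo`).

For the beta law, `q̂(m, n)` is a function of `m` times a function of `n`, and the relevant sums of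
Gamma quotients telescope. Hence the explicit function `f = stayGenFun θ z` satisfies `∑ q̂(m, n)
z^{1{n = m}} f(n) = f(m)` and tends to `1` at infinity (`hasSum_stayGenFun`, `tendsto_stayGenFun`).
So `f(Q̂_k) z^{Ĉ_k}` has constant mean `f(ℓ)`. For a real `z > 1` in the allowed disc, `f` is
bounded below on the states `n ≥ ℓ`, which bounds exponential moments of `Ĉ_k`. Thus the limit is
finite, `Q̂_k → ∞`, and dominated convergence gives `E z^{C_∞} = f(ℓ)` as well as the convergence of
moments.

The mixed Poisson law has generating function `E H^{θ - θz}`, a beta moment equal to `f(ℓ)`. The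
renewal probability is the case `ℓ = 1`, `z = 0`, with `0^C` the indicator of `C = 0`. -/

namespace StickBreaking

/-! ### Asymptotics of Gamma quotients, from Euler's limit formula. -/

section GammaRatios

open Complex in
-- The denominator of Euler's sequence is a rising factorial, which is a quotient of Gamma values.
-- This turns Euler's limit into an asymptotic formula for `Γ(k + 1 + a)`.
theorem gammaSeq_mul_Gamma {a : ℂ} (ha : 0 < a.re) (k : ℕ) :
    GammaSeq a k * Gamma (k + 1 + a) = (k : ℂ) ^ a * k.factorial * Gamma a := by
  have h : ∀ n : ℕ, Gamma (n + a) = (∏ j ∈ Finset.range n, (a + j)) * Gamma a := by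
    intro n
    induction n with
    | zero => simp
    | succ n ih =>
      have hne : (n : ℂ) + a ≠ 0 := fun h => by
        have := congrArg Complex.re h
        simp at this
        have : (0 : ℝ) ≤ n := n.cast_nonneg
        linarith
      rw [Finset.prod_range_succ, Nat.cast_succ, add_right_comm, Gamma_add_one _ hne, ih]
      ring
  have hp : (∏ j ∈ Finset.range (k + 1), (a + j)) ≠ 0 := by
    refine Finset.prod_ne_zero_iff.2 fun j _ h => ?_
    have := congrArg Complex.re h
    simp at this
    have : (0 : ℝ) ≤ j := j.cast_nonneg
    linarith
  have := h (k + 1)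
  push_cast at this
  rw [this, GammaSeq]
  field_simp

open Complex in
theorem tendsto_gammaSeq_div_Gamma {a : ℂ} (ha : 0 < a.re) :
    Tendsto (fun k => GammaSeq a k / Gamma a) atTop (𝓝 1) := by
  have := (GammaSeq_tendsto_Gamma a).div_const (Gamma a)
  rwa [div_self (Gamma_ne_zero_of_re_pos ha)] at this

open Complex in
theorem Gamma_natCast_add_eq {a : ℂ} (ha : 0 < a.re) {k : ℕ} (hk : k ≠ 0) :
    Gamma (k + 1 + a) = (k : ℂ) ^ a * k.factorial / (GammaSeq a k / Gamma a) := by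
  have h := gammaSeq_mul_Gamma ha k
  have hG := Gamma_ne_zero_of_re_pos ha
  have hk' : (k : ℂ) ^ a ≠ 0 := by
    rw [Ne, cpow_eq_zero_iff]
    simp [hk]
  have hs : GammaSeq a k ≠ 0 := by
    intro h0
    rw [h0, zero_mul] at h
    exact mul_ne_zero (mul_ne_zero hk' (by exact_mod_cast k.factorial_ne_zero)) hG h.symm
  field_simp
  linear_combination h

open Complex in
/-- Gamma quotients with balanced arguments tend to one. -/
theorem tendsto_Gamma_balanced {a b c d : ℂ} (ha : 0 < a.re) (hb : 0 < b.re) (hc : 0 < c.re)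
    (hd : 0 < d.re) (h : a + b = c + d) :
    Tendsto (fun k : ℕ => Gamma (k + 1 + a) * Gamma (k + 1 + b)
      / (Gamma (k + 1 + c) * Gamma (k + 1 + d))) atTop (𝓝 1) := by
  have key := ((tendsto_gammaSeq_div_Gamma hc).mul (tendsto_gammaSeq_div_Gamma hd)).div
    ((tendsto_gammaSeq_div_Gamma ha).mul (tendsto_gammaSeq_div_Gamma hb)) (by simp)
  simp only [mul_one, div_one] at key
  refine key.congr' ?_
  filter_upwards [eventually_ne_atTop 0] with k hk
  have hk' : ∀ a : ℂ, (k : ℂ) ^ a ≠ 0 := fun a => by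
    rw [Ne, cpow_eq_zero_iff]
    simp [hk]
  have hf : (k.factorial : ℂ) ≠ 0 := by exact_mod_cast k.factorial_ne_zero
  -- The balance `a + b = c + d` makes the powers of `k` cancel, leaving only factors that tend to
  -- one.
  have e : (k : ℂ) ^ a * (k : ℂ) ^ b = (k : ℂ) ^ c * (k : ℂ) ^ d := by
    rw [← cpow_add _ _ (by exact_mod_cast hk), ← cpow_add _ _ (by exact_mod_cast hk), h]
  simp only [Pi.div_apply]
  generalize hA : GammaSeq a k / Gamma a = A
  generalize hB : GammaSeq b k / Gamma b = B
  generalize hC : GammaSeq c k / Gamma c = C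
  generalize hD : GammaSeq d k / Gamma d = D
  rw [Gamma_natCast_add_eq ha hk, Gamma_natCast_add_eq hb hk, Gamma_natCast_add_eq hc hk,
    Gamma_natCast_add_eq hd hk, hA, hB, hC, hD, div_mul_div_comm, div_mul_div_comm, div_div_div_eq,
    show (k : ℂ) ^ a * k.factorial * ((k : ℂ) ^ b * k.factorial)
      = (k : ℂ) ^ c * k.factorial * ((k : ℂ) ^ d * k.factorial) by
      linear_combination (k.factorial : ℂ) ^ 2 * e, mul_comm (A * B), mul_div_mul_left]
  exact mul_ne_zero (mul_ne_zero (hk' _) hf) (mul_ne_zero (hk' _) hf)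

open Complex in
theorem tendsto_Gamma_div_Gamma_add {a : ℂ} (ha : 0 < a.re) {θ : ℝ} (hθ : 0 < θ) :
    Tendsto (fun k : ℕ => Gamma (k + 1 + a) / Gamma (k + 1 + (a + θ))) atTop (𝓝 0) := by
  have haθ : 0 < (a + θ).re := by simp; linarith
  -- The quotient is asymptotic to `k ^ (-θ)`.
  have h0 : Tendsto (fun k : ℕ => (k : ℂ) ^ (-θ : ℂ)) atTop (𝓝 0) := by
    rw [tendsto_zero_iff_norm_tendsto_zero]
    refine (tendsto_rpow_neg_atTop hθ).comp tendsto_natCast_atTop_atTop |>.congr' ?_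
    filter_upwards [eventually_gt_atTop 0] with k hk
    rw [Complex.norm_natCast_cpow_of_pos hk]
    simp
  have key := ((tendsto_gammaSeq_div_Gamma haθ).div (tendsto_gammaSeq_div_Gamma ha)
    (by simp)).mul h0
  simp only [mul_zero] at key
  refine key.congr' ?_
  filter_upwards [eventually_ne_atTop 0] with k hk
  have hk' : ∀ a : ℂ, (k : ℂ) ^ a ≠ 0 := fun a => by
    rw [Ne, cpow_eq_zero_iff]
    simp [hk]
  have hf : (k.factorial : ℂ) ≠ 0 := by exact_mod_cast k.factorial_ne_zero
  rw [Gamma_natCast_add_eq ha hk, Gamma_natCast_add_eq haθ hk,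
    cpow_add _ _ (by exact_mod_cast hk), cpow_neg, div_div_div_eq]
  simp only [Pi.div_apply]
  have h1 := hk' a
  have h2 := hk' θ
  have h3 := Gamma_ne_zero_of_re_pos ha
  field_simp

end GammaRatios

/-! ### Beta moments and the transition probabilities. -/

section BetaIntegrals

theorem betaPDFReal_of_notMem {a b x : ℝ} (hx : x ∉ Set.Ioo (0 : ℝ) 1) : betaPDFReal a b x = 0 :=
  if_neg hx

open Complex in
theorem integral_cpow_betaMeasure {a b : ℝ} (ha : 0 < a) (hb : 0 < b) {s t : ℂ}
    (hs : 0 < (a + s).re) (ht : 0 < (b + t).re) :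
    ∫ x : ℝ, (x : ℂ) ^ s * (1 - x : ℂ) ^ t ∂betaMeasure a b
      = Gamma (a + s) * Gamma (b + t) * Gamma (a + b)
        / (Gamma (a + b + s + t) * Gamma a * Gamma b) := by
  have h1 : ∫ x : ℝ, (x : ℂ) ^ s * (1 - x : ℂ) ^ t ∂betaMeasure a b
      = (1 / beta a b : ℝ) * betaIntegral (a + s) (b + t) := by
    rw [betaMeasure, integral_withDensity_eq_integral_toReal_smul
      (f := betaPDF a b) (measurable_betaPDFReal a b).ennreal_ofReal (by simp [betaPDF]), betaIntegral,
      intervalIntegral.integral_of_le zero_le_one, integral_Ioc_eq_integral_Ioo,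
      ← integral_const_mul, ← integral_indicator measurableSet_Ioo]
    refine integral_congr_ae (ae_of_all _ fun x => ?_)
    by_cases hx : x ∈ Set.Ioo (0 : ℝ) 1
    · have hx0 : (x : ℂ) ≠ 0 := by exact_mod_cast hx.1.ne'
      have hx1 : (1 - x : ℂ) ≠ 0 := by
        have := hx.2.ne'
        rw [sub_ne_zero]
        exact_mod_cast this
      have hpos := (betaPDFReal_pos hx.1 hx.2 ha hb).le
      simp only [Set.indicator_of_mem hx, betaPDF, ENNReal.toReal_ofReal hpos, real_smul]
      rw [betaPDFReal, if_pos ⟨hx.1, hx.2⟩]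
      push_cast
      rw [ofReal_cpow hx.1.le, ofReal_cpow (sub_nonneg.2 hx.2.le),
        show (a + s - 1 : ℂ) = (a - 1) + s by ring, show (b + t - 1 : ℂ) = (b - 1) + t by ring,
        cpow_add _ _ hx0, cpow_add _ _ hx1]
      push_cast
      ring
    · simp [Set.indicator_of_notMem hx, betaPDF, betaPDFReal_of_notMem hx]
  rw [h1, betaIntegral_eq_Gamma_mul_div _ _ hs ht, beta]
  have e : (a + s + (b + t) : ℂ) = a + b + s + t := by ring
  rw [e]
  push_cast [← Gamma_ofReal]
  have := Gamma_ne_zero_of_re_pos (s := a) (by simpa)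
  have := Gamma_ne_zero_of_re_pos (s := b) (by simpa)
  field_simp

/-- The factor `(n - m)!` of the beta moment cancels the one in the binomial coefficient. What
remains separates into a function of `m` and a function of `n`, so that sums over `n` can telescope.
-/
theorem transitionProb_beta {θ : ℝ} (hθ : 0 < θ) {m n : ℕ} (hm : 1 ≤ m) (hmn : m ≤ n) :
    (transitionProb (betaMeasure 1 θ) m n : ℂ)
      = Complex.Gamma (m + θ) / Complex.Gamma m
        * (θ * Complex.Gamma n / Complex.Gamma (n + 1 + θ)) := by
  obtain ⟨d, rfl⟩ := Nat.exists_eq_add_of_le hmn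
  obtain ⟨m, rfl⟩ := Nat.exists_eq_add_of_le' hm
  have h := integral_cpow_betaMeasure one_pos hθ (s := d) (t := (m + 1 : ℕ))
    (by simp; positivity) (by simp; positivity)
  rw [transitionProb, if_pos hmn, Complex.ofReal_mul, ← integral_complex_ofReal]
  simp only [Complex.cpow_natCast] at h
  push_cast at h ⊢
  have e : m + 1 + d - (m + 1) = d := by omega
  rw [e, h]
  rw [show m + 1 + d - 1 = m + d by omega]
  have hc : ((m + d).choose m : ℂ) * d.factorial * m.factorial
      = (m + d).factorial := by
    have := Nat.add_choose_mul_factorial_mul_factorial m d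
    have h2 : ((m + d).choose m * d.factorial * m.factorial) = (m + d).factorial := by
      rw [← this, Nat.choose_symm_add]; ring
    exact_mod_cast h2
  have h1 : Complex.Gamma (1 + d) = d.factorial := by
    rw [add_comm, Complex.Gamma_nat_eq_factorial]
  have h2 : Complex.Gamma (m + 1 + d) = (m + d).factorial := by
    rw [show (m + 1 + d : ℂ) = (m + d : ℕ) + 1 by push_cast; ring,
      Complex.Gamma_nat_eq_factorial]
  have h3 : Complex.Gamma (1 + θ) = θ * Complex.Gamma θ := by
    rw [add_comm, Complex.Gamma_add_one _ (by exact_mod_cast hθ.ne')]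
  rw [h1, h2, h3, ← hc, Complex.Gamma_nat_eq_factorial, Complex.Gamma_one,
    show (1 + θ + d + (m + 1) : ℂ) = m + 1 + d + 1 + θ by ring,
    show (θ + (m + 1) : ℂ) = m + 1 + θ by ring]
  have hG := Complex.Gamma_ne_zero_of_re_pos (s := θ) (by simpa)
  have hf : (m.factorial : ℂ) ≠ 0 := by exact_mod_cast m.factorial_ne_zero
  field_simp

theorem transitionProb_eq_zero (ν : Measure ℝ) {m n : ℕ} (h : n < m) :
    transitionProb ν m n = 0 := if_neg (not_le.2 h)

theorem ae_betaMeasure_mem_Ioo (a b : ℝ) : ∀ᵐ x ∂betaMeasure a b, x ∈ Set.Ioo (0 : ℝ) 1 := by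
  rw [betaMeasure, ae_withDensity_iff (f := betaPDF a b) (measurable_betaPDFReal a b).ennreal_ofReal]
  refine ae_of_all _ fun x hx => ?_
  by_contra h
  exact hx (by simp [betaPDF, betaPDFReal_of_notMem h])

theorem transitionProb_nonneg {ν : Measure ℝ} (hν : ∀ᵐ x ∂ν, x ∈ Set.Ioo (0 : ℝ) 1) (m n : ℕ) :
    0 ≤ transitionProb ν m n := by
  rw [transitionProb]
  split_ifs
  · refine mul_nonneg (Nat.cast_nonneg _) (integral_nonneg_of_ae ?_)
    filter_upwards [hν] with x hx
    exact mul_nonneg (pow_nonneg hx.1.le _) (pow_nonneg (sub_nonneg.2 hx.2.le) _)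
  · exact le_rfl

end BetaIntegrals

/-! ### The harmonic function and the telescoping sums behind it. -/

section Harmonic

/-- The generating function `E z^C` of the total number of stays of the chain started from `n`. -/
noncomputable def stayGenFun (θ : ℝ) (z : ℂ) (n : ℕ) : ℂ :=
  Complex.Gamma (n + 1 + θ) * Complex.Gamma (n + θ - θ * z)
    / (Complex.Gamma n * Complex.Gamma (n + 1 + 2 * θ - θ * z))

theorem mul_re_lt_of_norm_lt {θ : ℝ} (hθ : 0 < θ) {ℓ : ℕ} {z : ℂ} (hz : ‖z‖ < 1 + ℓ / θ) :
    θ * z.re < θ + ℓ := by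
  have h := (Complex.re_le_norm z).trans_lt hz
  calc θ * z.re < θ * (1 + ℓ / θ) := by gcongr
    _ = θ + ℓ := by field_simp

theorem tendsto_stayGenFun {θ : ℝ} (hθ : 0 < θ) {ℓ : ℕ} (hℓ : 1 ≤ ℓ) {z : ℂ}
    (hz : ‖z‖ < 1 + ℓ / θ) : Tendsto (stayGenFun θ z) atTop (𝓝 1) := by
  have hr := mul_re_lt_of_norm_lt hθ hz
  have hℓ' : (1 : ℝ) ≤ ℓ := by exact_mod_cast hℓ
  -- For `n < ℓ` the argument `n + θ - θz` may hit a pole. Beyond `ℓ` all Gamma arguments have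
  -- positive real part, because `θ Re z < θ + ℓ`.
  rw [← tendsto_add_atTop_iff_nat (ℓ + 1)]
  refine (tendsto_Gamma_balanced (a := ℓ + 1 + θ) (b := ℓ + θ - θ * z) (c := ℓ)
    (d := ℓ + 1 + 2 * θ - θ * z) ?_ ?_ ?_ ?_ (by ring)).congr fun k => ?_
  · simp; positivity
  · simp; linarith
  · simp; linarith
  · simp; linarith
  · rw [stayGenFun]
    push_cast
    congr 3 <;> ring

theorem stayGenFun_one {θ : ℝ} (hθ : 0 < θ) {n : ℕ} (hn : 1 ≤ n) : stayGenFun θ 1 n = 1 := by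
  have hn' : (1 : ℝ) ≤ n := by exact_mod_cast hn
  rw [stayGenFun, show (n + θ - θ * 1 : ℂ) = n by ring,
    show (n + 1 + 2 * θ - θ * 1 : ℂ) = n + 1 + θ by ring, mul_comm, div_self]
  refine mul_ne_zero (Complex.Gamma_ne_zero_of_re_pos ?_) (Complex.Gamma_ne_zero_of_re_pos ?_)
  · simp; linarith
  · simp; positivity

theorem Gamma_quotient_telescope {c : ℂ} (hc : 0 < c.re) {θ : ℝ} (hθ : 0 < θ) :
    θ * Complex.Gamma c / Complex.Gamma (c + 1 + θ)
      = Complex.Gamma c / Complex.Gamma (c + θ)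
        - Complex.Gamma (c + 1) / Complex.Gamma (c + 1 + θ) := by
  have hcθ : 0 < (c + θ).re := by simp; linarith
  have h0 : c ≠ 0 := fun h => by simp [h] at hc
  have h1 : c + θ ≠ 0 := fun h => by simp [h] at hcθ
  have h2 := Complex.Gamma_ne_zero_of_re_pos hcθ
  rw [show c + 1 + θ = c + θ + 1 by ring, Complex.Gamma_add_one _ h0, Complex.Gamma_add_one _ h1]
  field_simp
  ring

/-- The terms telescope and the remainder decays like `n ^ (-θ)`. Summability is assumed separately
because convergence of partial sums does not give unconditional convergence of complex terms. -/
theorem hasSum_Gamma_quotient {c : ℂ} (hc : 0 < c.re) {θ : ℝ} (hθ : 0 < θ)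
    (hs : Summable fun n : ℕ => θ * Complex.Gamma (c + n) / Complex.Gamma (c + n + 1 + θ)) :
    HasSum (fun n : ℕ => θ * Complex.Gamma (c + n) / Complex.Gamma (c + n + 1 + θ))
      (Complex.Gamma c / Complex.Gamma (c + θ)) := by
  rw [hs.hasSum_iff_tendsto_nat]
  have hG : Tendsto (fun n : ℕ => Complex.Gamma (c + n) / Complex.Gamma (c + n + θ)) atTop
      (𝓝 0) := by
    rw [← tendsto_add_atTop_iff_nat 1]
    refine (tendsto_Gamma_div_Gamma_add hc hθ).congr fun k => ?_
    push_cast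
    congr 2 <;> ring
  have := hG.const_sub (Complex.Gamma c / Complex.Gamma (c + θ))
  rw [sub_zero] at this
  refine this.congr fun n => ?_
  have e : ∀ n : ℕ, θ * Complex.Gamma (c + n) / Complex.Gamma (c + n + 1 + θ)
      = Complex.Gamma (c + n) / Complex.Gamma (c + n + θ)
        - Complex.Gamma (c + (n + 1 : ℕ)) / Complex.Gamma (c + (n + 1 : ℕ) + θ) := fun n => by
    rw [Gamma_quotient_telescope (c := c + n) (by simp; positivity) hθ]
    push_cast
    rw [add_assoc c n 1]
  simp only [e]
  rw [Finset.sum_range_sub']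
  simp

theorem summable_transitionProb_beta {θ : ℝ} (hθ : 0 < θ) {m : ℕ} (hm : 1 ≤ m) :
    Summable (transitionProb (betaMeasure 1 θ) m) := by
  have hm' : (1 : ℝ) ≤ m := by exact_mod_cast hm
  rw [← summable_nat_add_iff m]
  have hpos : ∀ n : ℕ, ∀ b : ℝ, 0 ≤ b → 0 < Real.Gamma (n + m + b) := fun n b hb =>
    Real.Gamma_pos_of_pos (by positivity)
  -- The partial sums telescope to the prefactor times (first term minus last term). Dropping the
  -- last term gives the bound, kept here in unsimplified form although it equals one.
  refine summable_of_sum_range_le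
    (c := Real.Gamma (m + θ) / Real.Gamma m * (Real.Gamma m / Real.Gamma (m + θ)))
    (fun n => transitionProb_nonneg (ae_betaMeasure_mem_Ioo 1 θ) _ _) fun N => ?_
  have e : ∀ n : ℕ, transitionProb (betaMeasure 1 θ) m (n + m)
      = Real.Gamma (m + θ) / Real.Gamma m * (Real.Gamma (n + m) / Real.Gamma (n + m + θ)
        - Real.Gamma ((n + 1 : ℕ) + m) / Real.Gamma ((n + 1 : ℕ) + m + θ)) := fun n => by
    have h := transitionProb_beta hθ hm (Nat.le_add_left m n)
    have h2 := Gamma_quotient_telescope (c := (n + m : ℕ)) (θ := θ) (by simp; positivity) hθ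
    rw [h2] at h
    rw [← Complex.ofReal_inj, h]
    push_cast [← Complex.Gamma_ofReal]
    rw [add_right_comm (n : ℂ) m 1]
  simp only [e]
  rw [← Finset.mul_sum, Finset.sum_range_sub']
  have h1 := (hpos 0 θ hθ.le).le
  have h2 := (hpos 0 0 le_rfl).le
  have h3 := (hpos N θ hθ.le).le
  have h4 := (hpos N 0 le_rfl).le
  simp only [Nat.cast_zero, zero_add, add_zero] at h1 h2 h3 h4 ⊢
  refine mul_le_mul_of_nonneg_left ?_ (div_nonneg h1 h2)
  exact sub_le_self _ (div_nonneg h4 h3)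

/-- The function `stayGenFun` is harmonic for the chain weighted by `z` at each stay. -/
theorem hasSum_stayGenFun {θ : ℝ} (hθ : 0 < θ) {ℓ : ℕ} (hℓ : 1 ≤ ℓ) {z : ℂ}
    (hz : ‖z‖ < 1 + ℓ / θ) {m : ℕ} (hm : ℓ ≤ m) :
    HasSum (fun n => (transitionProb (betaMeasure 1 θ) m n : ℂ) * (if n = m then z else 1)
      * stayGenFun θ z n) (stayGenFun θ z m) := by
  have hr := mul_re_lt_of_norm_lt hθ hz
  have hm1 : 1 ≤ m := hℓ.trans hm
  have hℓm : (ℓ : ℝ) ≤ m := by exact_mod_cast hm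
  have hm' : (1 : ℝ) ≤ m := by exact_mod_cast hm1
  obtain ⟨B, hB⟩ := (Metric.isBounded_range_of_tendsto _
    (tendsto_stayGenFun hθ hℓ hz)).exists_norm_le
  have hsum : Summable fun n => (transitionProb (betaMeasure 1 θ) m n : ℂ)
      * stayGenFun θ z n := by
    refine Summable.of_norm_bounded ((summable_transitionProb_beta hθ hm1).mul_right B) fun n => ?_
    have h0 := transitionProb_nonneg (ae_betaMeasure_mem_Ioo 1 θ) m n
    rw [norm_mul, Complex.norm_real, Real.norm_of_nonneg h0]
    exact mul_le_mul_of_nonneg_left (hB _ ⟨n, rfl⟩) h0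
  set s : ℂ := θ - θ * z with hs
  set A : ℂ := Complex.Gamma (m + θ) / Complex.Gamma m with hA
  have hne : ∀ {c : ℂ}, 0 < c.re → Complex.Gamma c ≠ 0 := Complex.Gamma_ne_zero_of_re_pos
  have hA0 : A ≠ 0 := div_ne_zero (hne (by simp; positivity)) (hne (by simp; linarith))
  -- The factors `Γ(n)` and `Γ(n + 1 + θ)` of `f` cancel those of the transition probability. What
  -- is left is again of telescoping form, shifted by `s`.
  have e : ∀ n, m ≤ n → (transitionProb (betaMeasure 1 θ) m n : ℂ) * stayGenFun θ z n
      = A * (θ * Complex.Gamma (n + s) / Complex.Gamma (n + s + 1 + θ)) := fun n hn => by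
    have hn' : (m : ℝ) ≤ n := by exact_mod_cast hn
    rw [transitionProb_beta hθ hm1 hn, stayGenFun, hs, hA,
      show (n + 1 + 2 * θ - θ * z : ℂ) = n + (θ - θ * z) + 1 + θ by ring,
      show (n + θ - θ * z : ℂ) = n + (θ - θ * z) by ring]
    have h1 : Complex.Gamma n ≠ 0 := hne (by simp; linarith)
    have h2 : Complex.Gamma (n + 1 + θ) ≠ 0 := hne (by simp; positivity)
    field_simp
  have hc : 0 < ((m : ℂ) + 1 + s).re := by simp [hs]; linarith
  have hc0 : 0 < ((m : ℂ) + s).re := by simp [hs]; linarith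
  have e' : ∀ n : ℕ, (transitionProb (betaMeasure 1 θ) m (n + (m + 1)) : ℂ)
      * stayGenFun θ z (n + (m + 1)) = A * (θ * Complex.Gamma (m + 1 + s + n)
        / Complex.Gamma (m + 1 + s + n + 1 + θ)) := fun n => by
    rw [e _ (by omega)]
    push_cast
    rw [show (n + (m + 1) + s : ℂ) = m + 1 + s + n by ring]
  have hsum1 := (summable_nat_add_iff (m + 1)).2 hsum
  simp only [e'] at hsum1
  have htail := (hasSum_Gamma_quotient hc hθ ((summable_mul_left_iff hA0).1 hsum1)).mul_left A
  -- Terms below `m` vanish, the diagonal term carries the weight `z`, and the tail telescopes. With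
  -- `c = m + s`, the diagonal and the tail combine to `A (θz + c) Γ(c) / Γ(c + 1 + θ)`, and `θz + c
  -- = m + θ` supplies the factor turning `Γ(m + θ)` into `Γ(m + θ + 1)`.
  rw [← hasSum_nat_add_iff' (m + 1), Finset.sum_range_succ, Finset.sum_eq_zero, zero_add]
  · rw [if_pos rfl, show (transitionProb (betaMeasure 1 θ) m m : ℂ) * z * stayGenFun θ z m
      = z * ((transitionProb (betaMeasure 1 θ) m m : ℂ) * stayGenFun θ z m) by ring, e m le_rfl]
    convert! htail using 1
    · ext n
      rw [← e', if_neg (by omega), mul_one]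
    · rw [Gamma_quotient_telescope hc0 hθ, stayGenFun, hA,
        show (m + 1 + 2 * θ - θ * z : ℂ) = m + s + θ + 1 by rw [hs]; ring,
        show (m + θ - θ * z : ℂ) = m + s by rw [hs]; ring,
        show (m + s + 1 + θ : ℂ) = m + s + θ + 1 by ring,
        show (m + 1 + s + θ : ℂ) = m + s + θ + 1 by ring,
        show (m + 1 + s : ℂ) = m + s + 1 by ring,
        show (m + 1 + θ : ℂ) = m + θ + 1 by ring]
      have hmθ : 0 < ((m : ℂ) + θ).re := by simp; positivity
      have hcθ : 0 < ((m : ℂ) + s + θ).re := by simp [hs]; linarith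
      have ne0 : ∀ {c : ℂ}, 0 < c.re → c ≠ 0 := fun h h0 => by simp [h0] at h
      have k1 := ne0 hcθ
      have k2 := hne hcθ
      have k3 : Complex.Gamma m ≠ 0 := hne (by simp; linarith)
      rw [Complex.Gamma_add_one _ (ne0 hcθ), Complex.Gamma_add_one _ (ne0 hc0),
        Complex.Gamma_add_one _ (ne0 hmθ)]
      field_simp
      rw [hs]
      ring
  · intro n hn
    rw [transitionProb_eq_zero _ (Finset.mem_range.1 hn)]
    simp

/-- At `z = 1` the harmonic function is identically one on the positive integers, so harmonicity
says that the rows sum to one. -/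
theorem hasSum_transitionProb_beta {θ : ℝ} (hθ : 0 < θ) {m : ℕ} (hm : 1 ≤ m) :
    HasSum (transitionProb (betaMeasure 1 θ) m) 1 := by
  have h := hasSum_stayGenFun hθ le_rfl (z := 1)
    (by simp only [norm_one]; have : 0 < ((1 : ℕ) : ℝ) / θ := by positivity
        linarith) hm
  rw [stayGenFun_one hθ hm] at h
  rw [← Complex.hasSum_ofReal]
  convert! h using 1
  ext n
  rcases Nat.eq_zero_or_pos n with rfl | hn
  · rw [transitionProb_eq_zero _ (by omega)]; simp
  · rw [stayGenFun_one hθ hn]; simp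

end Harmonic

/-! ### Finite paths, which form a countable set, and their stays. -/

section Paths

variable {Ω : Type*}

/-- The path of `Y` up to time `k`. -/
def pathTo (Y : ℕ → Ω → ℕ) (k : ℕ) (ω : Ω) : Fin (k + 1) → ℕ := fun i => Y i ω

/-- The extension of a finite path to all times. -/
def extendPath {k : ℕ} (x : Fin (k + 1) → ℕ) (j : ℕ) : ℕ := x (Fin.ofNat (k + 1) j)

theorem extendPath_of_le {k : ℕ} (x : Fin (k + 1) → ℕ) {j : ℕ} (hj : j ≤ k) :
    extendPath x j = x ⟨j, by omega⟩ := by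
  rw [extendPath]
  congr 1
  ext
  simp [Nat.mod_eq_of_lt (Nat.lt_succ_of_le hj)]

theorem extendPath_pathTo (Y : ℕ → Ω → ℕ) {k j : ℕ} (hj : j ≤ k) (ω : Ω) :
    extendPath (pathTo Y k ω) j = Y j ω := extendPath_of_le _ hj

theorem pathTo_preimage (Y : ℕ → Ω → ℕ) {k : ℕ} (x : Fin (k + 1) → ℕ) :
    pathTo Y k ⁻¹' {x} = {ω | ∀ j ≤ k, Y j ω = extendPath x j} := by
  ext ω
  simp only [Set.mem_preimage, Set.mem_singleton_iff, Set.mem_ofPred_eq, funext_iff]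
  constructor
  · intro h j hj
    rw [extendPath_of_le x hj]
    exact h ⟨j, by omega⟩
  · intro h i
    have := h i (by omega)
    rwa [extendPath_of_le x (by omega)] at this

theorem stayCount_succ (Y : ℕ → Ω → ℕ) (k : ℕ) (ω : Ω) :
    stayCount Y (k + 1) ω = stayCount Y k ω + if Y (k + 1) ω = Y k ω then 1 else 0 := by
  rw [stayCount, stayCount, ← Finset.insert_Icc_right_eq_Icc_add_one (by omega),
    Finset.filter_insert, Nat.add_sub_cancel]
  split_ifs with h
  · rw [Finset.card_insert_of_notMem (by simp)]
  · rfl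

theorem stayCount_zero (Y : ℕ → Ω → ℕ) (ω : Ω) : stayCount Y 0 ω = 0 := by
  simp [stayCount]

theorem stayCount_le (Y : ℕ → Ω → ℕ) (k : ℕ) (ω : Ω) : stayCount Y k ω ≤ k := by
  refine (Finset.card_filter_le _ _).trans ?_
  simp

theorem monotone_stayCount (Y : ℕ → Ω → ℕ) (ω : Ω) : Monotone fun k => stayCount Y k ω :=
  monotone_nat_of_le_succ fun k => by rw [stayCount_succ]; exact Nat.le_add_right _ _

theorem stayCount_congr {Ω₁ Ω₂ : Type*} {Y : ℕ → Ω₁ → ℕ} {Z : ℕ → Ω₂ → ℕ} {ω₁ : Ω₁} {ω₂ : Ω₂}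
    {k : ℕ} (h : ∀ j ≤ k, Y j ω₁ = Z j ω₂) : stayCount Y k ω₁ = stayCount Z k ω₂ := by
  rw [stayCount, stayCount]
  congr 1
  refine Finset.filter_congr fun j hj => ?_
  rw [Finset.mem_Icc] at hj
  rw [h j hj.2, h (j - 1) (by omega)]

/-- The number of stays as a function of the path. -/
def pathStays {k : ℕ} (x : Fin (k + 1) → ℕ) : ℕ := stayCount (fun j x => extendPath x j) k x

theorem stayCount_eq_pathStays (Y : ℕ → Ω → ℕ) (k : ℕ) (ω : Ω) :
    stayCount Y k ω = pathStays (pathTo Y k ω) :=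
  stayCount_congr fun _ hj => (extendPath_pathTo Y hj ω).symm

theorem norm_pow_stayCount_le (z : ℂ) (Y : ℕ → Ω → ℕ) {k : ℕ} (ω : Ω) :
    ‖z ^ stayCount Y k ω‖ ≤ max 1 ‖z‖ ^ k := by
  rw [norm_pow]
  calc ‖z‖ ^ stayCount Y k ω ≤ max 1 ‖z‖ ^ stayCount Y k ω := by gcongr; exact le_max_right _ _
    _ ≤ max 1 ‖z‖ ^ k := pow_le_pow_right₀ (le_max_left _ _) (stayCount_le Y k ω)

end Paths

/-! ### Chains on a finite horizon and the martingale identity. -/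

section FiniteHorizon

variable {Ω : Type*} [MeasurableSpace Ω]

/-- Up to time `K`, the sequence `Y` is a Markov chain with transition function `q` started from
the state `ℓ`. -/
structure IsChainUpTo (q : ℕ → ℕ → ℝ) (ℓ K : ℕ) (μ : Measure Ω) (Y : ℕ → Ω → ℕ) : Prop where
  measurable : ∀ j, Measurable (Y j)
  law : ∀ k ≤ K, ∀ x : ℕ → ℕ, μ.real {ω | ∀ j ≤ k, Y j ω = x j}
    = if x 0 = ℓ then ∏ j ∈ Finset.range k, q (x j) (x (j + 1)) else 0

theorem IsMarkovChainFrom.isChainUpTo {q : ℕ → ℕ → ℝ} {ℓ : ℕ} {μ : Measure Ω}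
    [IsProbabilityMeasure μ] {Y : ℕ → Ω → ℕ} (h : IsMarkovChainFrom q ℓ μ Y) (K : ℕ) :
    IsChainUpTo q ℓ K μ Y := by
  refine ⟨h.measurable, fun k _ x => ?_⟩
  induction k with
  | zero =>
    simp only [Nat.le_zero, forall_eq, Finset.range_zero, Finset.prod_empty]
    split_ifs with hx
    · have : {ω | Y 0 ω = x 0} =ᵐ[μ] Set.univ := by
        rw [ae_eq_univ, ← mem_ae_iff]
        filter_upwards [h.initial] with ω hω
        exact hω.trans hx.symm
      rw [measureReal_congr this, probReal_univ]
    · rw [measureReal_def, measure_eq_zero_iff_ae_notMem.2, ENNReal.toReal_zero]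
      filter_upwards [h.initial] with ω hω hω'
      exact hx (hω'.symm.trans hω)
  | succ k ih =>
    rw [h.step, ih (by omega), Finset.prod_range_succ, ite_mul, zero_mul]

theorem measurable_pathTo {Y : ℕ → Ω → ℕ} (hY : ∀ j, Measurable (Y j)) (k : ℕ) :
    Measurable (pathTo Y k) := measurable_pi_lambda _ fun i => hY i

theorem measurable_stayCount {Y : ℕ → Ω → ℕ} (hY : ∀ j, Measurable (Y j)) (k : ℕ) :
    Measurable (stayCount Y k) := by
  have : stayCount Y k = pathStays ∘ pathTo Y k := funext fun ω => stayCount_eq_pathStays Y k ω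
  rw [this]
  exact (Measurable.of_discrete (f := pathStays)).comp (measurable_pathTo hY k)

/-- Almost every point lies in a fibre of positive measure. -/
theorem ae_measure_fiber_ne_zero {β : Type*} [Countable β] (μ : Measure Ω) (X : Ω → β) :
    ∀ᵐ ω ∂μ, μ (X ⁻¹' {X ω}) ≠ 0 := by
  have : {ω | ¬ μ (X ⁻¹' {X ω}) ≠ 0} ⊆ ⋃ b : {b : β // μ (X ⁻¹' {b}) = 0}, X ⁻¹' {b.1} := by
    intro ω hω
    simp only [Set.mem_ofPred_eq, not_not] at hω
    exact Set.mem_iUnion.2 ⟨⟨X ω, hω⟩, rfl⟩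
  exact measure_mono_null this (measure_iUnion_null fun b => b.2)

theorem hasSum_integral_fiber {β E : Type*} [Countable β] [MeasurableSpace β]
    [MeasurableSingletonClass β] [NormedAddCommGroup E] [NormedSpace ℝ E] {μ : Measure Ω}
    {X : Ω → β} (hX : Measurable X) {f : Ω → E} (hf : Integrable f μ) :
    HasSum (fun b => ∫ ω in X ⁻¹' {b}, f ω ∂μ) (∫ ω, f ω ∂μ) := by
  have hU : ⋃ b, X ⁻¹' {b} = Set.univ := by
    ext ω; simp
  have := hasSum_integral_iUnion (μ := μ) (f := f) (s := fun b => X ⁻¹' {b})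
    (fun b => hX (measurableSet_singleton b))
    (fun a b hab => by
      refine Set.disjoint_left.2 fun ω h1 h2 => hab ?_
      exact h1.symm.trans h2) hf.integrableOn
  rwa [hU, setIntegral_univ] at this

variable {q : ℕ → ℕ → ℝ} {ℓ K : ℕ} {μ : Measure Ω} {Y : ℕ → Ω → ℕ}

theorem IsChainUpTo.map_pathTo_eq {Ω' : Type*} [MeasurableSpace Ω'] {μ' : Measure Ω'}
    [IsFiniteMeasure μ] [IsFiniteMeasure μ'] {Z : ℕ → Ω' → ℕ}
    (hY : IsChainUpTo q ℓ K μ Y) (hZ : IsChainUpTo q ℓ K μ' Z) :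
    μ.map (pathTo Y K) = μ'.map (pathTo Z K) := by
  refine Measure.ext_of_singleton fun x => ?_
  rw [Measure.map_apply (measurable_pathTo hY.measurable K) (measurableSet_singleton x),
    Measure.map_apply (measurable_pathTo hZ.measurable K) (measurableSet_singleton x),
    pathTo_preimage, pathTo_preimage, ← measureReal_eq_measureReal_iff, hY.law K le_rfl,
    hZ.law K le_rfl]

theorem IsChainUpTo.map_stayCount_eq {Ω' : Type*} [MeasurableSpace Ω'] {μ' : Measure Ω'}
    [IsFiniteMeasure μ] [IsFiniteMeasure μ'] {Z : ℕ → Ω' → ℕ}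
    (hY : IsChainUpTo q ℓ K μ Y) (hZ : IsChainUpTo q ℓ K μ' Z) :
    μ.map (stayCount Y K) = μ'.map (stayCount Z K) := by
  have h1 : stayCount Y K = pathStays ∘ pathTo Y K :=
    funext fun ω => stayCount_eq_pathStays Y K ω
  have h2 : stayCount Z K = pathStays ∘ pathTo Z K :=
    funext fun ω => stayCount_eq_pathStays Z K ω
  rw [h1, h2, ← Measure.map_map .of_discrete (measurable_pathTo hY.measurable K),
    ← Measure.map_map .of_discrete (measurable_pathTo hZ.measurable K), hY.map_pathTo_eq hZ]

/-- Almost every point has a path of positive probability. All factors of that probability are then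
nonzero, which excludes downward steps and a wrong initial state. -/
theorem IsChainUpTo.ae_path [IsFiniteMeasure μ] (hY : IsChainUpTo q ℓ K μ Y)
    (hq : ∀ m n, n < m → q m n = 0) :
    ∀ᵐ ω ∂μ, Y 0 ω = ℓ ∧ ∀ j < K, Y j ω ≤ Y (j + 1) ω := by
  filter_upwards [ae_measure_fiber_ne_zero μ (pathTo Y K)] with ω hω
  have h := hY.law K le_rfl (extendPath (pathTo Y K ω))
  rw [← pathTo_preimage] at h
  have hne : μ.real (pathTo Y K ⁻¹' {pathTo Y K ω}) ≠ 0 :=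
    (ENNReal.toReal_pos hω (measure_ne_top _ _)).ne'
  rw [h] at hne
  split_ifs at hne with h0
  · refine ⟨(extendPath_pathTo Y (Nat.zero_le K) ω).symm.trans h0, fun j hj => ?_⟩
    by_contra! hlt
    have := Finset.prod_ne_zero_iff.1 hne j (Finset.mem_range.2 hj)
    rw [extendPath_pathTo Y hj.le, extendPath_pathTo Y hj] at this
    exact this (hq _ _ hlt)
  · exact absurd rfl hne

theorem IsChainUpTo.ae_le [IsFiniteMeasure μ] (hY : IsChainUpTo q ℓ K μ Y)
    (hq : ∀ m n, n < m → q m n = 0) : ∀ᵐ ω ∂μ, ∀ j ≤ K, ℓ ≤ Y j ω := by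
  filter_upwards [hY.ae_path hq] with ω hω j
  induction j with
  | zero => exact fun _ => hω.1.ge
  | succ j ih => exact fun h => (ih (by omega)).trans (hω.2 j (by omega))

/-- This is the Markov property in integrated form, with `F` a weight depending on the past: split
over the paths up to time `k`, then over the next state. Harmonicity is needed only at states `m ≥
ℓ`, since the chain never goes below `ℓ`. -/
theorem IsChainUpTo.integral_step [IsFiniteMeasure μ] (hY : IsChainUpTo q ℓ K μ Y)
    (hq : ∀ m n, n < m → q m n = 0) {k : ℕ} (hk : k < K) {φ : ℕ → ℕ → ℂ} {ψ : ℕ → ℂ}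
    (h : ∀ m, ℓ ≤ m → HasSum (fun n => (q m n : ℂ) * φ m n) (ψ m))
    (F : (Fin (k + 1) → ℕ) → ℂ)
    (h1 : Integrable (fun ω => F (pathTo Y k ω) * φ (Y k ω) (Y (k + 1) ω)) μ)
    (h2 : Integrable (fun ω => F (pathTo Y k ω) * ψ (Y k ω)) μ) :
    ∫ ω, F (pathTo Y k ω) * φ (Y k ω) (Y (k + 1) ω) ∂μ
      = ∫ ω, F (pathTo Y k ω) * ψ (Y k ω) ∂μ := by
  have hX := measurable_pathTo hY.measurable k
  refine (hasSum_integral_fiber hX h1).unique ?_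
  convert hasSum_integral_fiber hX h2 using 2 with x
  have hA : MeasurableSet (pathTo Y k ⁻¹' {x}) := hX (measurableSet_singleton x)
  have hYk : ∀ ω ∈ pathTo Y k ⁻¹' {x}, Y k ω = extendPath x k := fun ω hω => by
    rw [pathTo_preimage] at hω
    exact hω k le_rfl
  have hR : ∫ ω in pathTo Y k ⁻¹' {x}, F (pathTo Y k ω) * ψ (Y k ω) ∂μ
      = μ.real (pathTo Y k ⁻¹' {x}) * (F x * ψ (extendPath x k)) := by
    rw [setIntegral_congr_fun hA (g := fun _ => F x * ψ (extendPath x k))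
      (fun ω hω => by simp only [hYk ω hω]; rw [show pathTo Y k ω = x from hω]),
      setIntegral_const, Complex.real_smul]
  rw [hR]
  refine (hasSum_integral_fiber (hY.measurable (k + 1)) h1.integrableOn).unique ?_
  have hL : ∀ n, ∫ ω in Y (k + 1) ⁻¹' {n}, F (pathTo Y k ω) * φ (Y k ω) (Y (k + 1) ω)
        ∂(μ.restrict (pathTo Y k ⁻¹' {x}))
      = (μ.real (pathTo Y k ⁻¹' {x}) * F x) *
        ((q (extendPath x k) n : ℂ) * φ (extendPath x k) n) := fun n => by
    have hB := hY.measurable (k + 1) (measurableSet_singleton n)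
    rw [Measure.restrict_restrict hB, setIntegral_congr_fun (hB.inter hA)
      (g := fun _ => F x * φ (extendPath x k) n)
      (fun ω hω => by
        simp only [hYk ω hω.2]
        rw [show pathTo Y k ω = x from hω.2, show Y (k + 1) ω = n from hω.1]),
      setIntegral_const, Complex.real_smul]
    have e : Y (k + 1) ⁻¹' {n} ∩ pathTo Y k ⁻¹' {x}
        = {ω | ∀ j ≤ k + 1, Y j ω = if j ≤ k then extendPath x j else n} := by
      rw [pathTo_preimage]
      ext ω
      simp only [Set.mem_inter_iff, Set.mem_preimage, Set.mem_singleton_iff, Set.mem_ofPred_eq]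
      constructor
      · rintro ⟨ha, hb⟩ j hj
        split_ifs with hjk
        · exact hb j hjk
        · rw [show j = k + 1 by omega, ha]
      · intro hj
        refine ⟨?_, fun j hjk => ?_⟩
        · simpa using hj (k + 1) le_rfl
        · simpa [hjk] using hj j (by omega)
    have e2 : μ.real (Y (k + 1) ⁻¹' {n} ∩ pathTo Y k ⁻¹' {x})
        = μ.real (pathTo Y k ⁻¹' {x}) * q (extendPath x k) n := by
      rw [e, hY.law _ hk, pathTo_preimage, hY.law _ hk.le, Finset.prod_range_succ]
      simp only [Nat.zero_le, if_true, le_refl, Nat.not_succ_le_self, if_false, ite_mul, zero_mul]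
      congr 2
      refine Finset.prod_congr rfl fun j hj => ?_
      rw [Finset.mem_range] at hj
      rw [if_pos hj.le, if_pos (by omega)]
    rw [e2]
    push_cast
    ring
  simp only [hL, ← mul_assoc (μ.real _ : ℂ)]
  -- On a null fibre both sides vanish. On the others the last state is at least `ℓ`, so that `h`
  -- applies.
  by_cases h0 : μ (pathTo Y k ⁻¹' {x}) = 0
  · simp [measureReal_def, h0, hasSum_zero]
  · refine (h _ ?_).mul_left _
    obtain ⟨ω, hω, hω'⟩ := Measure.exists_mem_of_measure_ne_zero_of_ae h0
      (ae_restrict_of_ae (hY.ae_le hq))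
    rw [← hYk ω hω]
    exact hω' k hk.le

theorem integrable_mul_pow_stayCount [IsFiniteMeasure μ] (hY : ∀ j, Measurable (Y j))
    {f : ℕ → ℂ} {B : ℝ} (hf : ∀ n, ‖f n‖ ≤ B) (z : ℂ) (k : ℕ) :
    Integrable (fun ω => f (Y k ω) * z ^ stayCount Y k ω) μ := by
  refine Integrable.of_bound (C := B * max 1 ‖z‖ ^ k) ?_ (ae_of_all _ fun ω => ?_)
  · have h1 : Measurable fun ω => f (Y k ω) := Measurable.of_discrete.comp (hY k)
    have h2 : Measurable fun ω => z ^ stayCount Y k ω :=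
      (Measurable.of_discrete (f := fun n : ℕ => z ^ n)).comp (measurable_stayCount hY k)
    exact (h1.mul h2).aestronglyMeasurable
  · rw [norm_mul]
    exact mul_le_mul (hf _) (norm_pow_stayCount_le z Y ω) (norm_nonneg _)
      ((norm_nonneg _).trans (hf 0))

/-- A function harmonic for the chain weighted by `z` at each stay yields a martingale. -/
theorem IsChainUpTo.integral_mul_pow_stayCount [IsProbabilityMeasure μ]
    (hY : IsChainUpTo q ℓ K μ Y) (hq : ∀ m n, n < m → q m n = 0) {f : ℕ → ℂ} {B : ℝ}
    (hf : ∀ n, ‖f n‖ ≤ B) {z : ℂ}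
    (h : ∀ m, ℓ ≤ m → HasSum (fun n => (q m n : ℂ) * (if n = m then z else 1) * f n) (f m))
    {k : ℕ} (hk : k ≤ K) : ∫ ω, f (Y k ω) * z ^ stayCount Y k ω ∂μ = f ℓ := by
  induction k with
  | zero =>
    rw [integral_congr_ae (g := fun _ => f ℓ)]
    · simp
    · filter_upwards [hY.ae_path hq] with ω hω
      simp [hω.1, stayCount_zero]
  | succ k ih =>
    rw [← ih (by omega)]
    have h1 := integrable_mul_pow_stayCount (μ := μ) hY.measurable hf z (k + 1)
    have h2 := integrable_mul_pow_stayCount (μ := μ) hY.measurable hf z k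
    have e1 : (fun ω => f (Y (k + 1) ω) * z ^ stayCount Y (k + 1) ω)
        = fun ω => z ^ pathStays (pathTo Y k ω)
          * ((fun m n => (if n = m then z else 1) * f n) (Y k ω) (Y (k + 1) ω)) := by
      ext ω
      rw [stayCount_succ, stayCount_eq_pathStays Y k]
      dsimp only
      split_ifs
      · ring
      · ring
    have e2 : (fun ω => f (Y k ω) * z ^ stayCount Y k ω)
        = fun ω => z ^ pathStays (pathTo Y k ω) * f (Y k ω) := by
      ext ω
      rw [stayCount_eq_pathStays Y k, mul_comm]
    rw [e1] at h1
    rw [e2] at h2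
    rw [e1, e2]
    exact hY.integral_step hq hk (F := fun x => z ^ pathStays x)
      (fun m hm => by simpa only [mul_assoc] using h m hm) h1 h2

end FiniteHorizon

/-! ### Upper and lower bounds for the harmonic function. -/

section StayGenFun

theorem exists_norm_stayGenFun_le {θ : ℝ} (hθ : 0 < θ) {ℓ : ℕ} (hℓ : 1 ≤ ℓ) {z : ℂ}
    (hz : ‖z‖ < 1 + ℓ / θ) : ∃ B, ∀ n, ‖stayGenFun θ z n‖ ≤ B := by
  obtain ⟨B, hB⟩ := (Metric.isBounded_range_of_tendsto _
    (tendsto_stayGenFun hθ hℓ hz)).exists_norm_le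
  exact ⟨B, fun n => hB _ ⟨n, rfl⟩⟩

/-- For real arguments the generating function is real, and bounded away from zero. -/
theorem exists_le_stayGenFun {θ : ℝ} (hθ : 0 < θ) {ℓ : ℕ} (hℓ : 1 ≤ ℓ) {r : ℝ} (hr0 : 0 ≤ r)
    (hr : r < 1 + ℓ / θ) :
    ∃ g : ℕ → ℝ, (∀ n, stayGenFun θ r n = g n) ∧ ∃ c > 0, ∀ n, ℓ ≤ n → c ≤ g n := by
  have hz : ‖(r : ℂ)‖ < 1 + ℓ / θ := by rwa [Complex.norm_real, Real.norm_of_nonneg hr0]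
  have hre := mul_re_lt_of_norm_lt hθ hz
  rw [Complex.ofReal_re] at hre
  let g : ℕ → ℝ := fun n => Real.Gamma (n + 1 + θ) * Real.Gamma (n + θ - θ * r)
    / (Real.Gamma n * Real.Gamma (n + 1 + 2 * θ - θ * r))
  have hg : ∀ n, stayGenFun θ r n = g n := fun n => by
    simp only [stayGenFun, g]
    push_cast [← Complex.Gamma_ofReal]
    rfl
  refine ⟨g, hg, ?_⟩
  have hpos : ∀ n, ℓ ≤ n → 0 < g n := fun n hn => by
    have h1 : (1 : ℝ) ≤ ℓ := by exact_mod_cast hℓ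
    have h2 : (ℓ : ℝ) ≤ n := by exact_mod_cast hn
    have := Real.Gamma_pos_of_pos (s := n + 1 + θ) (by linarith)
    have := Real.Gamma_pos_of_pos (s := n + θ - θ * r) (by linarith)
    have := Real.Gamma_pos_of_pos (s := n) (by linarith)
    have := Real.Gamma_pos_of_pos (s := n + 1 + 2 * θ - θ * r) (by linarith)
    positivity
  have ht : Tendsto g atTop (𝓝 1) := by
    have := tendsto_stayGenFun hθ hℓ hz
    rw [show stayGenFun θ r = fun n => (g n : ℂ) from funext hg] at this
    exact_mod_cast (Complex.continuous_re.tendsto _).comp this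
  obtain ⟨N, hN⟩ := eventually_atTop.1 
    (ht.eventually (lt_mem_nhds (show (1 / 2 : ℝ) < 1 by norm_num)))
  obtain ⟨n₀, hn₀, hmin⟩ := Finset.exists_min_image (Finset.Icc ℓ (max ℓ N)) g
    ⟨ℓ, Finset.mem_Icc.2 ⟨le_rfl, le_max_left _ _⟩⟩
  -- Beyond `N` the limit `1` gives the bound `1 / 2`; the finitely many earlier states are handled
  -- by the positive minimum at `n₀`.
  refine ⟨min (1 / 2) (g n₀), lt_min (by norm_num) (hpos _ (Finset.mem_Icc.1 hn₀).1),
    fun n hn => ?_⟩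
  rcases le_total N n with h | h
  · exact (min_le_left _ _).trans (hN n h).le
  · exact (min_le_right _ _).trans
      (hmin n (Finset.mem_Icc.2 ⟨hn, h.trans (le_max_right _ _)⟩))

end StayGenFun

/-! ### The total number of stays along one path. -/

section TotalStays

variable {Ω : Type*} {Y : ℕ → Ω → ℕ}

/-- The total number of stays. -/
noncomputable def totalStays (Y : ℕ → Ω → ℕ) (ω : Ω) : ℕ := ⨆ k, stayCount Y k ω

/-- Boundedness is essential: the supremum of an unbounded set of naturals is `0` by convention. -/
theorem tendsto_stayCount_totalStays {ω : Ω}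
    (h : BddAbove (Set.range fun k => stayCount Y k ω)) :
    Tendsto (fun k => stayCount Y k ω) atTop (𝓝 (totalStays Y ω)) :=
  tendsto_atTop_ciSup (monotone_stayCount Y ω) h

theorem stayCount_le_totalStays {ω : Ω}
    (h : BddAbove (Set.range fun k => stayCount Y k ω)) (k : ℕ) :
    stayCount Y k ω ≤ totalStays Y ω := le_ciSup h k

/-- With finitely many stays, a nondecreasing integer path is eventually strictly increasing. -/
theorem tendsto_atTop_of_stayCount_bddAbove {ω : Ω} (hmono : ∀ j, Y j ω ≤ Y (j + 1) ω)
    (h : BddAbove (Set.range fun k => stayCount Y k ω)) :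
    Tendsto (fun k => Y k ω) atTop atTop := by
  have hev : ∀ᶠ k in atTop, stayCount Y k ω = totalStays Y ω :=
    tendsto_pure.1 (nhds_discrete ℕ ▸ tendsto_stayCount_totalStays h)
  obtain ⟨N, hN⟩ := eventually_atTop.1 hev
  have hlt : ∀ k, N ≤ k → Y k ω < Y (k + 1) ω := fun k hk => by
    refine lt_of_le_of_ne (hmono k) fun he => ?_
    have h1 := stayCount_succ Y k ω
    rw [hN k hk, hN (k + 1) (by omega), if_pos he.symm] at h1
    omega
  have hle : ∀ k, k ≤ Y (k + N) ω := fun k => by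
    induction k with
    | zero => exact Nat.zero_le _
    | succ k ih =>
      have := hlt (k + N) (by omega)
      rw [add_right_comm]
      omega
  exact (tendsto_add_atTop_iff_nat N).1 (tendsto_atTop_mono hle tendsto_id)

end TotalStays

/-! ### Finiteness, generating function and moments of the limit. -/

section Limit

variable {Ω : Type*} [MeasurableSpace Ω] {μ : Measure Ω} {Y : ℕ → Ω → ℕ} {θ : ℝ} {ℓ : ℕ}

theorem measurable_totalStays (hY : ∀ j, Measurable (Y j)) : Measurable (totalStays Y) :=
  Measurable.iSup fun k => measurable_stayCount hY k

theorem integral_stayGenFun_mul_pow [IsProbabilityMeasure μ] (hθ : 0 < θ) (hℓ : 1 ≤ ℓ) {K : ℕ}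
    (hY : IsChainUpTo (transitionProb (betaMeasure 1 θ)) ℓ K μ Y) {z : ℂ}
    (hz : ‖z‖ < 1 + ℓ / θ) {k : ℕ} (hk : k ≤ K) :
    ∫ ω, stayGenFun θ z (Y k ω) * z ^ stayCount Y k ω ∂μ = stayGenFun θ z ℓ := by
  obtain ⟨B, hB⟩ := exists_norm_stayGenFun_le hθ hℓ hz
  exact hY.integral_mul_pow_stayCount (fun _ _ => transitionProb_eq_zero _) hB
    (fun m hm => hasSum_stayGenFun hθ hℓ hz hm) hk

/-- With `c` a positive lower bound for `f` on the states reached, `c E[r^{C_k}] ≤ E[f(Y_k) r^{C_k}]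
= f(ℓ)`. -/
theorem exists_lintegral_pow_stayCount_le [IsProbabilityMeasure μ] (hθ : 0 < θ) (hℓ : 1 ≤ ℓ)
    (hY : ∀ K, IsChainUpTo (transitionProb (betaMeasure 1 θ)) ℓ K μ Y) {r : ℝ} (hr0 : 0 ≤ r)
    (hr : r < 1 + ℓ / θ) :
    ∃ M : ℝ≥0∞, M < ∞ ∧ ∀ k, ∫⁻ ω, ENNReal.ofReal (r ^ stayCount Y k ω) ∂μ ≤ M := by
  obtain ⟨g, hg, c, hc, hgc⟩ := exists_le_stayGenFun hθ hℓ hr0 hr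
  have hz : ‖(r : ℂ)‖ < 1 + ℓ / θ := by rwa [Complex.norm_real, Real.norm_of_nonneg hr0]
  obtain ⟨B, hB⟩ := exists_norm_stayGenFun_le hθ hℓ hz
  refine ⟨ENNReal.ofReal (g ℓ / c), ENNReal.ofReal_lt_top, fun k => ?_⟩
  have h1 := integral_stayGenFun_mul_pow hθ hℓ (hY k) hz le_rfl
  have h2 := integrable_mul_pow_stayCount (μ := μ) (hY k).measurable hB r k
  simp only [hg] at h1 h2
  norm_cast at h1 h2
  have h2' : Integrable (fun ω => g (Y k ω) * r ^ stayCount Y k ω) μ := by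
    simpa only [RCLike.re_to_complex, Complex.ofReal_re] using h2.re
  have hae := (hY k).ae_le (fun _ _ => transitionProb_eq_zero _)
  have h3 : ∫⁻ ω, ENNReal.ofReal (g (Y k ω) * r ^ stayCount Y k ω) ∂μ = ENNReal.ofReal (g ℓ) := by
    rw [← h1, ofReal_integral_eq_lintegral_ofReal h2']
    filter_upwards [hae] with ω hω
    exact mul_nonneg (hc.le.trans (hgc _ (hω k le_rfl))) (pow_nonneg hr0 _)
  rw [ENNReal.ofReal_div_of_pos hc, ENNReal.le_div_iff_mul_le (Or.inl (by simpa using hc))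
    (Or.inl ENNReal.ofReal_ne_top), ← h3, mul_comm, ← lintegral_const_mul' _ _ ENNReal.ofReal_ne_top]
  refine lintegral_mono_ae ?_
  filter_upwards [hae] with ω hω
  rw [← ENNReal.ofReal_mul hc.le]
  exact ENNReal.ofReal_le_ofReal
    (mul_le_mul_of_nonneg_right (hgc _ (hω k le_rfl)) (pow_nonneg hr0 _))

/-- For one `r > 1` in the allowed range, monotone convergence gives `sup_k r^{C_k}` a finite mean,
hence a finite value almost surely. -/
theorem ae_bddAbove_stayCount [IsProbabilityMeasure μ] (hθ : 0 < θ) (hℓ : 1 ≤ ℓ)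
    (hY : ∀ K, IsChainUpTo (transitionProb (betaMeasure 1 θ)) ℓ K μ Y) :
    ∀ᵐ ω ∂μ, BddAbove (Set.range fun k => stayCount Y k ω) := by
  have hpos : 0 < ℓ / θ := by have : (0 : ℝ) < ℓ := by exact_mod_cast hℓ
                              positivity
  obtain ⟨M, hM, h⟩ := exists_lintegral_pow_stayCount_le hθ hℓ hY (r := 1 + ℓ / θ / 2)
    (by positivity) (by linarith)
  set r : ℝ := 1 + ℓ / θ / 2
  have hr : 1 < r := by simp only [r]; linarith
  have hmeas : ∀ k, Measurable fun ω => ENNReal.ofReal (r ^ stayCount Y k ω) := fun k =>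
    (Measurable.of_discrete (f := fun n : ℕ => ENNReal.ofReal (r ^ n))).comp
      (measurable_stayCount (hY 0).measurable k)
  have hsup : ∫⁻ ω, ⨆ k, ENNReal.ofReal (r ^ stayCount Y k ω) ∂μ ≤ M := by
    rw [lintegral_iSup hmeas]
    · exact iSup_le h
    · intro i j hij ω
      exact ENNReal.ofReal_le_ofReal
        (pow_le_pow_right₀ hr.le (monotone_stayCount Y ω hij))
  filter_upwards [ae_lt_top (Measurable.iSup hmeas) (hsup.trans_lt hM).ne] with ω hω
  by_contra hb
  refine hω.ne (ENNReal.eq_top_of_forall_nnreal_le fun a => ?_)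
  obtain ⟨n, hn⟩ := pow_unbounded_of_one_lt (a : ℝ) hr
  rw [bddAbove_def] at hb
  push Not at hb
  obtain ⟨_, ⟨k, rfl⟩, hk⟩ := hb n
  refine le_iSup_of_le k ?_
  rw [← ENNReal.ofReal_coe_nnreal]
  exact ENNReal.ofReal_le_ofReal (hn.le.trans (pow_le_pow_right₀ hr.le hk.le))

/-- Fatou's lemma applied to the uniform bound; this also covers `r ≤ 1`. -/
theorem integrable_pow_totalStays [IsProbabilityMeasure μ] (hθ : 0 < θ) (hℓ : 1 ≤ ℓ)
    (hY : ∀ K, IsChainUpTo (transitionProb (betaMeasure 1 θ)) ℓ K μ Y) {r : ℝ} (hr0 : 0 ≤ r)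
    (hr : r < 1 + ℓ / θ) : Integrable (fun ω => r ^ totalStays Y ω) μ := by
  obtain ⟨M, hM, h⟩ := exists_lintegral_pow_stayCount_le hθ hℓ hY hr0 hr
  have hmeas : ∀ k, Measurable fun ω => ENNReal.ofReal (r ^ stayCount Y k ω) := fun k =>
    (Measurable.of_discrete (f := fun n : ℕ => ENNReal.ofReal (r ^ n))).comp
      (measurable_stayCount (hY 0).measurable k)
  refine ⟨((Measurable.of_discrete (f := fun n : ℕ => r ^ n)).comp
    (measurable_totalStays (hY 0).measurable)).aestronglyMeasurable, ?_⟩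
  rw [hasFiniteIntegral_iff_ofReal (ae_of_all _ fun ω => pow_nonneg hr0 _)]
  refine lt_of_le_of_lt ?_ hM
  calc ∫⁻ ω, ENNReal.ofReal (r ^ totalStays Y ω) ∂μ
      = ∫⁻ ω, liminf (fun k => ENNReal.ofReal (r ^ stayCount Y k ω)) atTop ∂μ := by
        refine lintegral_congr_ae ?_
        filter_upwards [ae_bddAbove_stayCount hθ hℓ hY] with ω hω
        refine (Tendsto.liminf_eq ?_).symm
        exact ((continuous_of_discreteTopology
          (f := fun n : ℕ => ENNReal.ofReal (r ^ n))).tendsto _).comp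
          (tendsto_stayCount_totalStays hω)
    _ ≤ liminf (fun k => ∫⁻ ω, ENNReal.ofReal (r ^ stayCount Y k ω) ∂μ) atTop :=
        lintegral_liminf_le hmeas
    _ ≤ M := liminf_le_of_le (by isBoundedDefault) fun b hb => by
        obtain ⟨k, hk⟩ := hb.exists
        exact hk.trans (h k)

theorem integrable_and_integral_pow_totalStays [IsProbabilityMeasure μ] (hθ : 0 < θ) (hℓ : 1 ≤ ℓ)
    (hY : ∀ K, IsChainUpTo (transitionProb (betaMeasure 1 θ)) ℓ K μ Y) {z : ℂ}
    (hz : ‖z‖ < 1 + ℓ / θ) :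
    Integrable (fun ω => z ^ totalStays Y ω) μ ∧
      ∫ ω, z ^ totalStays Y ω ∂μ = stayGenFun θ z ℓ := by
  have hm := (hY 0).measurable
  have hpos : 0 < ℓ / θ := by have : (0 : ℝ) < ℓ := by exact_mod_cast hℓ
                              positivity
  have hmeas : Measurable fun ω => z ^ totalStays Y ω :=
    (Measurable.of_discrete (f := fun n : ℕ => z ^ n)).comp (measurable_totalStays hm)
  constructor
  · refine (integrable_pow_totalStays hθ hℓ hY (norm_nonneg z) hz).mono'
      hmeas.aestronglyMeasurable (ae_of_all _ fun ω => by rw [norm_pow])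
  obtain ⟨B, hB⟩ := exists_norm_stayGenFun_le hθ hℓ hz
  -- Taking the maximum with `1` makes the powers increase with the exponent, so that the total
  -- number of stays provides a dominating function for all `k`.
  have hR : max 1 ‖z‖ < 1 + ℓ / θ := max_lt (by linarith) hz
  have hint := (integrable_pow_totalStays hθ hℓ hY (le_trans zero_le_one (le_max_left 1 ‖z‖))
    hR).const_mul B
  have hbdd := ae_bddAbove_stayCount hθ hℓ hY
  have hpath : ∀ᵐ ω ∂μ, ∀ j, Y j ω ≤ Y (j + 1) ω := by
    rw [ae_all_iff]
    intro j
    filter_upwards [(hY (j + 1)).ae_path (fun _ _ => transitionProb_eq_zero _)] with ω hω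
    exact hω.2 j (by omega)
  have hlim : Tendsto (fun k => ∫ ω, stayGenFun θ z (Y k ω) * z ^ stayCount Y k ω ∂μ) atTop
      (𝓝 (∫ ω, z ^ totalStays Y ω ∂μ)) := by
    refine tendsto_integral_of_dominated_convergence _
      (fun k => (integrable_mul_pow_stayCount hm hB z k).1) hint (fun k => ?_) ?_
    · filter_upwards [hbdd] with ω hω
      rw [norm_mul, norm_pow]
      refine mul_le_mul (hB _) ?_ (by positivity) ((norm_nonneg _).trans (hB 0))
      calc ‖z‖ ^ stayCount Y k ω ≤ max 1 ‖z‖ ^ stayCount Y k ω := by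
            gcongr; exact le_max_right _ _
        _ ≤ max 1 ‖z‖ ^ totalStays Y ω :=
            pow_le_pow_right₀ (le_max_left _ _) (stayCount_le_totalStays hω k)
    · filter_upwards [hbdd, hpath] with ω hω hω'
      -- The chain tends to infinity, so the harmonic factor disappears in the limit.
      have h1 := (tendsto_stayGenFun hθ hℓ hz).comp (tendsto_atTop_of_stayCount_bddAbove hω' hω)
      have h2 := ((continuous_of_discreteTopology (f := fun n : ℕ => z ^ n)).tendsto _).comp
        (tendsto_stayCount_totalStays hω)
      simpa using h1.mul h2
  simp only [integral_stayGenFun_mul_pow hθ hℓ (hY _) hz le_rfl] at hlim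
  exact tendsto_nhds_unique hlim tendsto_const_nhds

theorem exists_natCast_rpow_le {p : ℝ} (hp : 0 < p) {r : ℝ} (hr : 1 < r) :
    ∃ B : ℝ, ∀ n : ℕ, (n : ℝ) ^ p ≤ B * r ^ n := by
  obtain ⟨k, hk⟩ := exists_nat_ge p
  obtain ⟨B, hB⟩ := (tendsto_pow_const_div_const_pow_of_one_lt k hr).bddAbove_range
  refine ⟨max B 0, fun n => ?_⟩
  have hrn : 0 < r ^ n := pow_pos (by linarith) n
  rcases Nat.eq_zero_or_pos n with rfl | hn
  · rw [Nat.cast_zero, Real.zero_rpow hp.ne']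
    positivity
  · calc (n : ℝ) ^ p ≤ (n : ℝ) ^ (k : ℝ) :=
          Real.rpow_le_rpow_of_exponent_le (by exact_mod_cast hn) hk
      _ = (n : ℝ) ^ k := Real.rpow_natCast _ _
      _ ≤ B * r ^ n := (div_le_iff₀ hrn).1 (hB ⟨n, rfl⟩)
      _ ≤ max B 0 * r ^ n := by gcongr; exact le_max_left _ _

theorem integrable_rpow_totalStays [IsProbabilityMeasure μ] (hθ : 0 < θ) (hℓ : 1 ≤ ℓ)
    (hY : ∀ K, IsChainUpTo (transitionProb (betaMeasure 1 θ)) ℓ K μ Y) {p : ℝ} (hp : 0 < p) :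
    Integrable (fun ω => (totalStays Y ω : ℝ) ^ p) μ := by
  have hpos : 0 < ℓ / θ := by have : (0 : ℝ) < ℓ := by exact_mod_cast hℓ
                              positivity
  obtain ⟨B, hB⟩ := exists_natCast_rpow_le hp (r := 1 + ℓ / θ / 2) (by linarith)
  refine ((integrable_pow_totalStays hθ hℓ hY (r := 1 + ℓ / θ / 2) (by positivity)
    (by linarith)).const_mul B).mono' ?_ (ae_of_all _ fun ω => ?_)
  · exact ((Measurable.of_discrete (f := fun n : ℕ => (n : ℝ) ^ p)).comp
      (measurable_totalStays (hY 0).measurable)).aestronglyMeasurable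
  · rw [Real.norm_of_nonneg (by positivity)]
    exact hB _

theorem tendsto_integral_rpow_stayCount [IsProbabilityMeasure μ] (hθ : 0 < θ) (hℓ : 1 ≤ ℓ)
    (hY : ∀ K, IsChainUpTo (transitionProb (betaMeasure 1 θ)) ℓ K μ Y) {p : ℝ} (hp : 0 < p) :
    Tendsto (fun k => ∫ ω, (stayCount Y k ω : ℝ) ^ p ∂μ) atTop
      (𝓝 (∫ ω, (totalStays Y ω : ℝ) ^ p ∂μ)) := by
  have hbdd := ae_bddAbove_stayCount hθ hℓ hY
  refine tendsto_integral_of_dominated_convergence _ (fun k => ?_)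
    (integrable_rpow_totalStays hθ hℓ hY hp) (fun k => ?_) ?_
  · exact ((Measurable.of_discrete (f := fun n : ℕ => (n : ℝ) ^ p)).comp
      (measurable_stayCount (hY 0).measurable k)).aestronglyMeasurable
  · filter_upwards [hbdd] with ω hω
    rw [Real.norm_of_nonneg (by positivity)]
    exact Real.rpow_le_rpow (by positivity) (by exact_mod_cast stayCount_le_totalStays hω k) hp.le
  · filter_upwards [hbdd] with ω hω
    exact ((continuous_of_discreteTopology (f := fun n : ℕ => (n : ℝ) ^ p)).tendsto _).comp
        (tendsto_stayCount_totalStays hω)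

end Limit

/-! ### Identification of the limit as a mixed Poisson law. -/

section MixedPoisson

instance isProbabilityMeasure_mixedPoisson (ρ : Measure ℝ≥0) [IsProbabilityMeasure ρ] :
    IsProbabilityMeasure (mixedPoisson ρ) := by
  constructor
  rw [mixedPoisson, Measure.bind_apply MeasurableSet.univ measurable_poisson.aemeasurable]
  simp

theorem integral_pow_poissonMeasure (r : ℝ≥0) (t : ℝ) :
    ∫ n : ℕ, Complex.exp (t * Complex.I) ^ n ∂poissonMeasure r
      = Complex.exp (r * (Complex.exp (t * Complex.I) - 1)) := by
  rw [← charFun_map_cast_poissonMeasure, charFun_apply, integral_map .of_discrete (by fun_prop)]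
  refine integral_congr_ae (ae_of_all _ fun n => ?_)
  simp only [← Complex.exp_nat_mul]
  congr 1
  simp
  ring

theorem integral_mixedPoisson {ρ : Measure ℝ≥0} [IsProbabilityMeasure ρ] {f : ℕ → ℂ}
    (hf : Integrable f (mixedPoisson ρ)) :
    ∫ n, f n ∂mixedPoisson ρ = ∫ r, ∫ n, f n ∂poissonMeasure r ∂ρ := by
  let κ : Kernel ℝ≥0 ℕ := ⟨poissonMeasure, measurable_poisson⟩
  have : IsMarkovKernel κ := ⟨fun r => inferInstanceAs (IsProbabilityMeasure (poissonMeasure r))⟩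
  have e : mixedPoisson ρ = (κ ∘ₖ Kernel.const Unit ρ) () := by
    rw [Kernel.comp_apply, Kernel.const_apply]
    rfl
  rw [e] at hf ⊢
  rw [Kernel.integral_comp hf, Kernel.const_apply]
  rfl

/-- Given `H`, the Poisson generating function at `z` is `exp(-θ log H (z - 1)) = H^{θ - θz}`, and
its mean is a beta moment. -/
theorem integral_pow_mixedPoisson_beta {θ : ℝ} (hθ : 0 < θ) {ℓ : ℕ} (hℓ : 1 ≤ ℓ) (t : ℝ) :
    ∫ n : ℕ, Complex.exp (t * Complex.I) ^ n
        ∂mixedPoisson ((betaMeasure ℓ (θ + 1)).map fun h => (-θ * Real.log h).toNNReal)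
      = stayGenFun θ (Complex.exp (t * Complex.I)) ℓ := by
  have hℓ' : (1 : ℝ) ≤ ℓ := by exact_mod_cast hℓ
  have hmeas : Measurable fun h : ℝ => (-θ * Real.log h).toNNReal := by fun_prop
  have := isProbabilityMeasureBeta (α := ℓ) (β := θ + 1) (by linarith) (by linarith)
  have := Measure.isProbabilityMeasure_map (μ := betaMeasure ℓ (θ + 1)) hmeas.aemeasurable
  have hz1 : ‖Complex.exp (t * Complex.I)‖ = 1 := Complex.norm_exp_ofReal_mul_I t
  rw [integral_mixedPoisson]
  · simp only [integral_pow_poissonMeasure]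
    set z := Complex.exp (t * Complex.I)
    have hre : z.re ≤ 1 := (Complex.re_le_norm z).trans hz1.le
    have hre' : θ * z.re ≤ θ := by nlinarith
    rw [integral_map hmeas.aemeasurable (by fun_prop)]
    have h := integral_cpow_betaMeasure (a := ℓ) (b := θ + 1) (s := θ - θ * z) (t := 0)
      (by linarith) (by linarith) (by simp; linarith) (by simp; linarith)
    rw [integral_congr_ae (g := fun x : ℝ => (x : ℂ) ^ (θ - θ * z) * (1 - x : ℂ) ^ (0 : ℂ)), h,
      stayGenFun]
    · have hG : Complex.Gamma (θ + 1) ≠ 0 := Complex.Gamma_ne_zero_of_re_pos (by simp; linarith)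
      push_cast
      rw [show (ℓ + (θ + 1) + (θ - θ * z) + 0 : ℂ) = ℓ + 1 + 2 * θ - θ * z by ring,
        show (ℓ + (θ - θ * z) : ℂ) = ℓ + θ - θ * z by ring,
        show (ℓ + (θ + 1) : ℂ) = ℓ + 1 + θ by ring, add_zero]
      field_simp
    -- Almost surely `0 < H < 1`, so the parameter is nonnegative and the truncation `toNNReal`
    -- changes nothing.
    · filter_upwards [ae_betaMeasure_mem_Ioo ℓ (θ + 1)] with x hx
      have hlog : 0 ≤ -θ * Real.log x := by
        have := Real.log_neg hx.1 hx.2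
        nlinarith
      have hx0 : (x : ℂ) ≠ 0 := by exact_mod_cast hx.1.ne'
      rw [Complex.cpow_zero, mul_one, Complex.cpow_def_of_ne_zero hx0, ← Complex.ofReal_log hx.1.le,
        Real.coe_toNNReal _ hlog]
      congr 1
      push_cast
      ring
  · refine Integrable.of_bound (C := 1) .of_discrete (ae_of_all _ fun n => ?_)
    rw [norm_pow, hz1, one_pow]

/-- A probability measure on `ℕ` is determined by its generating function on the unit circle. -/
theorem ext_of_integral_pow {ρ₁ ρ₂ : Measure ℕ} [IsProbabilityMeasure ρ₁] [IsProbabilityMeasure ρ₂]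
    (h : ∀ t : ℝ, ∫ n : ℕ, Complex.exp (t * Complex.I) ^ n ∂ρ₁
      = ∫ n : ℕ, Complex.exp (t * Complex.I) ^ n ∂ρ₂) : ρ₁ = ρ₂ := by
  have e : ∀ ρ : Measure ℕ, ∀ t : ℝ, charFun (ρ.map (Nat.cast : ℕ → ℝ)) t
      = ∫ n : ℕ, Complex.exp (t * Complex.I) ^ n ∂ρ := fun ρ t => by
    rw [charFun_apply, integral_map .of_discrete (by fun_prop)]
    refine integral_congr_ae (ae_of_all _ fun n => ?_)
    simp only [← Complex.exp_nat_mul]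
    congr 1
    simp
    ring
  have := Measure.isProbabilityMeasure_map (μ := ρ₁) (f := (Nat.cast : ℕ → ℝ)) .of_discrete
  have := Measure.isProbabilityMeasure_map (μ := ρ₂) (f := (Nat.cast : ℕ → ℝ)) .of_discrete
  have hmap : ρ₁.map (Nat.cast : ℕ → ℝ) = ρ₂.map (Nat.cast : ℕ → ℝ) :=
    Measure.ext_of_charFun (funext fun t => by rw [e, e, h])
  refine Measure.ext_of_singleton fun n => ?_
  have hn := congrArg (fun ν => ν {(n : ℝ)}) hmap
  have hpre : (Nat.cast : ℕ → ℝ) ⁻¹' {(n : ℝ)} = {n} := by ext m; simp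
  simpa only [Measure.map_apply Measurable.of_discrete (measurableSet_singleton (n : ℝ)), hpre]
    using hn

theorem map_totalStays {Ω : Type*} [MeasurableSpace Ω] {μ : Measure Ω} [IsProbabilityMeasure μ]
    {Y : ℕ → Ω → ℕ} {θ : ℝ} {ℓ : ℕ} (hθ : 0 < θ) (hℓ : 1 ≤ ℓ)
    (hY : ∀ K, IsChainUpTo (transitionProb (betaMeasure 1 θ)) ℓ K μ Y) :
    μ.map (totalStays Y)
      = mixedPoisson ((betaMeasure ℓ (θ + 1)).map fun h => (-θ * Real.log h).toNNReal) := by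
  have hℓ' : (1 : ℝ) ≤ ℓ := by exact_mod_cast hℓ
  have hm := measurable_totalStays (hY 0).measurable
  have := isProbabilityMeasureBeta (α := ℓ) (β := θ + 1) (by linarith) (by linarith)
  have := Measure.isProbabilityMeasure_map (μ := betaMeasure ℓ (θ + 1))
    (f := fun h => (-θ * Real.log h).toNNReal) (by fun_prop)
  have := Measure.isProbabilityMeasure_map (μ := μ) hm.aemeasurable
  refine ext_of_integral_pow fun t => ?_
  rw [integral_pow_mixedPoisson_beta hθ hℓ, integral_map hm.aemeasurable .of_discrete]
  refine (integrable_and_integral_pow_totalStays hθ hℓ hY ?_).2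
  rw [Complex.norm_exp_ofReal_mul_I]
  have : 0 < ℓ / θ := by positivity
  linarith

end MixedPoisson

/-! ### The probability that no stay occurs. -/

section NoStay

variable {θ : ℝ}

/-- The probability of no stay up to time `k`, for a chain started from `1`. -/
theorem tendsto_measureReal_stayCount_eq_zero {Ω : Type*} [MeasurableSpace Ω] {μ : Measure Ω}
    [IsProbabilityMeasure μ] (hθ : 0 < θ) {Y : ℕ → ℕ → Ω → ℕ}
    (hY : ∀ k, IsChainUpTo (transitionProb (betaMeasure 1 θ)) 1 k μ (Y k)) :
    Tendsto (fun k => μ.real {ω | stayCount (Y k) k ω = 0}) atTop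
      (𝓝 (Real.Gamma (θ + 2) * Real.Gamma (θ + 1) / Real.Gamma (2 * θ + 2))) := by
  have hz : ‖(0 : ℂ)‖ < 1 + (1 : ℕ) / θ := by
    rw [norm_zero]
    positivity
  have hval : stayGenFun θ 0 1
      = (Real.Gamma (θ + 2) * Real.Gamma (θ + 1) / Real.Gamma (2 * θ + 2) : ℝ) := by
    rw [stayGenFun]
    push_cast [← Complex.Gamma_ofReal]
    rw [show (1 + 1 + θ : ℂ) = θ + 2 by ring, show (1 + θ - θ * 0 : ℂ) = θ + 1 by ring,
      show (1 + 1 + 2 * θ - θ * 0 : ℂ) = 2 * θ + 2 by ring, Complex.Gamma_one, one_mul]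
  rw [Metric.tendsto_atTop]
  intro ε hε
  obtain ⟨N, hN⟩ := Metric.tendsto_atTop.1 (tendsto_stayGenFun hθ le_rfl hz) (ε / 2) (half_pos hε)
  refine ⟨N, fun k hk => lt_of_le_of_lt ?_ (half_lt_self hε)⟩
  obtain ⟨B, hB⟩ := exists_norm_stayGenFun_le hθ le_rfl hz
  have h1 := integral_stayGenFun_mul_pow hθ le_rfl (hY k) hz le_rfl
  have i1 := integrable_mul_pow_stayCount (μ := μ) (hY k).measurable hB 0 k
  have i2 := integrable_mul_pow_stayCount (μ := μ) (hY k).measurable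
    (f := fun _ => 1) (B := 1) (by simp) 0 k
  -- Since `0 ^ 0 = 1`, the power is the indicator of the event without stays.
  have h2 : ∫ ω, 1 * (0 : ℂ) ^ stayCount (Y k) k ω ∂μ
      = (μ.real {ω | stayCount (Y k) k ω = 0} : ℝ) := by
    have hms : MeasurableSet {ω | stayCount (Y k) k ω = 0} :=
      measurable_stayCount (hY k).measurable k (measurableSet_singleton 0)
    have : (fun ω => 1 * (0 : ℂ) ^ stayCount (Y k) k ω)
        = {ω | stayCount (Y k) k ω = 0}.indicator fun _ => 1 := by
      ext ω
      by_cases h : stayCount (Y k) k ω = 0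
      · rw [Set.indicator_of_mem (by exact h), h, pow_zero, mul_one]
      · rw [Set.indicator_of_notMem (by exact h), zero_pow h, mul_zero]
    rw [this, integral_indicator hms, setIntegral_const, Complex.real_smul, mul_one]
  rw [dist_comm, Real.dist_eq, ← Real.norm_eq_abs, ← Complex.norm_real, Complex.ofReal_sub, ← hval, ← h2, ← h1,
    ← integral_sub i1 i2]
  -- The chain `Y k` varies with `k`, so a pathwise limit is not available. Instead a uniform bound
  -- is used: without stays `Y k k ≥ k`, where `f` is within `ε / 2` of `1`, and otherwise the
  -- integrand vanishes.
  refine (norm_integral_le_of_norm_le_const (C := ε / 2) ?_).trans (by simp)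
  filter_upwards [(hY k).ae_path (fun _ _ => transitionProb_eq_zero _)] with ω hω
  rw [← sub_mul, norm_mul, norm_pow, norm_zero]
  by_cases h : stayCount (Y k) k ω = 0
  · rw [h, pow_zero, mul_one, ← dist_eq_norm]
    refine (hN _ ?_).le
    have hj : ∀ j ≤ k, j ≤ Y k j ω := fun j => by
      induction j with
      | zero => exact fun _ => Nat.zero_le _
      | succ j ih =>
        intro hjk
        have h3 : stayCount (Y k) (j + 1) ω = 0 :=
          Nat.le_zero.1 (h ▸ monotone_stayCount (Y k) ω hjk)
        rw [stayCount_succ] at h3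
        have h4 : Y k (j + 1) ω ≠ Y k j ω := fun he => by rw [if_pos he] at h3; omega
        have h5 := hω.2 j (by omega)
        have h6 := ih (by omega)
        omega
    exact hk.trans (hj k le_rfl)
  · rw [zero_pow h, mul_zero]
    positivity

end NoStay

/-! ### Deterministic facts about sticks, counts and hitting times. -/

section Pathwise

variable {Ω : Type*} {W U : ℕ → Ω → ℝ} {ω : Ω}

theorem endpoint_zero (W : ℕ → Ω → ℝ) (ω : Ω) : endpoint W 0 ω = 0 := by simp [endpoint]

theorem endpoint_succ (W : ℕ → Ω → ℝ) (k : ℕ) (ω : Ω) :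
    endpoint W (k + 1) ω = endpoint W k ω + stickLength W k ω := by
  rw [endpoint, endpoint, Finset.sum_range_succ]

theorem one_sub_endpoint (W : ℕ → Ω → ℝ) (k : ℕ) (ω : Ω) :
    1 - endpoint W k ω = ∏ j ∈ Finset.range k, (1 - W j ω) := by
  induction k with
  | zero => simp [endpoint_zero]
  | succ k ih =>
    rw [endpoint_succ, stickLength, Finset.prod_range_succ, ← ih]
    ring

theorem monotone_endpoint (hW : ∀ i, W i ω ∈ Set.Ioo (0 : ℝ) 1) :
    Monotone fun k => endpoint W k ω :=
  monotone_nat_of_le_succ fun k => by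
    rw [endpoint_succ, stickLength]
    have : 0 ≤ ∏ j ∈ Finset.range k, (1 - W j ω) :=
      Finset.prod_nonneg fun j _ => sub_nonneg.2 (hW j).2.le
    have := mul_nonneg this (hW k).1.le
    linarith

theorem endpoint_le_one (hW : ∀ i, W i ω ∈ Set.Ioo (0 : ℝ) 1) (k : ℕ) : endpoint W k ω ≤ 1 := by
  have : 0 ≤ ∏ j ∈ Finset.range k, (1 - W j ω) :=
    Finset.prod_nonneg fun j _ => sub_nonneg.2 (hW j).2.le
  rw [← one_sub_endpoint] at this
  linarith

theorem endpoint_nonneg (hW : ∀ i, W i ω ∈ Set.Ioo (0 : ℝ) 1) (k : ℕ) : 0 ≤ endpoint W k ω :=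
  (endpoint_zero W ω).symm.le.trans (monotone_endpoint hW (Nat.zero_le k))

theorem outsideCount_zero_left (W U : ℕ → Ω → ℝ) (k : ℕ) (ω : Ω) :
    outsideCount W U 0 k ω = 0 := by simp [outsideCount]

open Classical in
theorem outsideCount_succ (W U : ℕ → Ω → ℝ) (n k : ℕ) (ω : Ω) :
    outsideCount W U (n + 1) k ω
      = outsideCount W U n k ω + if endpoint W k ω ≤ U n ω then 1 else 0 := by
  rw [outsideCount, outsideCount, Finset.range_add_one, Finset.filter_insert]
  split_ifs
  · rw [Finset.card_insert_of_notMem (by simp)]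
  · rfl

theorem monotone_outsideCount (W U : ℕ → Ω → ℝ) (k : ℕ) (ω : Ω) :
    Monotone fun n => outsideCount W U n k ω :=
  monotone_nat_of_le_succ fun n => by rw [outsideCount_succ]; exact Nat.le_add_right _ _

theorem outsideCount_zero_right (hU : ∀ i, 0 ≤ U i ω) (n : ℕ) : outsideCount W U n 0 ω = n := by
  rw [outsideCount, Finset.filter_true_of_mem, Finset.card_range]
  intro i _
  rw [endpoint_zero]
  exact hU i

/-- The count grows by at most one per point, so `n` is the first time at level `ℓ` exactly when the
last point was counted. Requiring the count to equal `ℓ` excludes the default value `0` of an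
unattained hitting time. -/
theorem hittingTime_eq_iff {ℓ : ℕ} (hℓ : 1 ≤ ℓ) (k n : ℕ) :
    (hittingTime W U k ℓ ω = n ∧ outsideCount W U n k ω = ℓ)
      ↔ (1 ≤ n ∧ outsideCount W U n k ω = ℓ ∧ endpoint W k ω ≤ U (n - 1) ω) := by
  constructor
  · rintro ⟨h1, h2⟩
    have hn : 1 ≤ n := by
      rw [Nat.one_le_iff_ne_zero]
      rintro rfl
      rw [outsideCount_zero_left] at h2
      omega
    refine ⟨hn, h2, ?_⟩
    by_contra hU
    obtain ⟨m, rfl⟩ := Nat.exists_eq_add_of_le' hn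
    rw [Nat.add_sub_cancel] at hU
    rw [outsideCount_succ, if_neg hU, add_zero] at h2
    have : hittingTime W U k ℓ ω ≤ m := Nat.sInf_le h2
    omega
  · rintro ⟨hn, h2, hU⟩
    refine ⟨le_antisymm (Nat.sInf_le h2) (le_csInf ⟨n, h2⟩ fun m hm => ?_), h2⟩
    obtain ⟨n, rfl⟩ := Nat.exists_eq_add_of_le' hn
    rw [Nat.add_sub_cancel] at hU
    by_contra! hlt
    have h3 := monotone_outsideCount W U k ω (Nat.le_of_lt_succ hlt)
    simp only [show outsideCount W U m k ω = ℓ from hm] at h3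
    rw [outsideCount_succ, if_pos hU] at h2
    omega

/-- The numbers of points outside the first `K, K - 1, …, 0` intervals, at the first time at which
`ℓ` points are outside the first `K` intervals. -/
noncomputable def reversedCount (W U : ℕ → Ω → ℝ) (ℓ K j : ℕ) (ω : Ω) : ℕ :=
  outsideCount W U (hittingTime W U K ℓ ω) (K - j) ω

/-- Reversal `j ↦ k + 1 - j` matches empty intervals with stays. -/
theorem emptyCount_eq_stayCount (W U : ℕ → Ω → ℝ) (ℓ k : ℕ) (ω : Ω) :
    emptyCount W U ℓ k ω = stayCount (reversedCount W U ℓ k) k ω := by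
  rw [emptyCount, stayCount]
  refine Finset.card_bij' (fun j _ => k + 1 - j) (fun j _ => k + 1 - j) ?_ ?_ ?_ ?_
  · intro j hj
    rw [Finset.mem_filter, Finset.mem_Icc] at hj ⊢
    refine ⟨by omega, ?_⟩
    rw [reversedCount, reversedCount, show k - (k + 1 - j) = j - 1 by omega,
      show k - (k + 1 - j - 1) = j by omega]
    exact hj.2.symm
  · intro j hj
    rw [Finset.mem_filter, Finset.mem_Icc] at hj ⊢
    refine ⟨by omega, ?_⟩
    have := hj.2
    rw [reversedCount, reversedCount, show k - (j - 1) = k + 1 - j by omega,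
      show k - j = k + 1 - j - 1 by omega] at this
    exact this.symm
  · intro j hj
    rw [Finset.mem_filter, Finset.mem_Icc] at hj
    omega
  · intro j hj
    rw [Finset.mem_filter, Finset.mem_Icc] at hj
    omega

theorem outsideCount_ne_iff (hR : Monotone fun k => endpoint W k ω) (n i : ℕ) :
    outsideCount W U n (i + 1) ω ≠ outsideCount W U n i ω
      ↔ ∃ b < n, U b ω ∈ interval W i ω := by
  classical
  have hsub : ((Finset.range n).filter fun b => endpoint W (i + 1) ω ≤ U b ω)
      ⊆ (Finset.range n).filter fun b => endpoint W i ω ≤ U b ω :=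
    Finset.monotone_filter_right _ fun b _ hb => (hR (Nat.le_succ i)).trans hb
  constructor
  · intro h
    by_contra! hne
    refine h ?_
    rw [outsideCount, outsideCount]
    congr 1
    refine Finset.filter_congr fun b hb => ⟨fun h => (hR (Nat.le_succ i)).trans h, fun h => ?_⟩
    by_contra! hlt
    exact hne b (Finset.mem_range.1 hb) ⟨h, hlt⟩
  · rintro ⟨b, hb, hU⟩ h
    rw [outsideCount, outsideCount] at h
    have := Finset.eq_of_subset_of_card_le hsub h.ge
    have hmem : b ∈ (Finset.range n).filter fun b => endpoint W i ω ≤ U b ω :=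
      Finset.mem_filter.2 ⟨Finset.mem_range.2 hb, hU.1⟩
    rw [← this, Finset.mem_filter] at hmem
    exact absurd hU.2 (not_lt.2 hmem.2)

theorem emptyCount_eq_zero_iff (hR : Monotone fun k => endpoint W k ω) {k : ℕ}
    (hN : outsideCount W U (hittingTime W U k 1 ω) k ω = 1) :
    emptyCount W U 1 k ω = 0 ↔
      ∀ i < k, ∃ j, 1 ≤ j ∧ j < hittingTime W U k 1 ω ∧ U (j - 1) ω ∈ interval W i ω := by
  obtain ⟨hpos, -, hU⟩ := (hittingTime_eq_iff le_rfl k _).1 ⟨rfl, hN⟩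
  have h1 : emptyCount W U 1 k ω = 0 ↔ ∀ i < k,
      outsideCount W U (hittingTime W U k 1 ω) (i + 1) ω
        ≠ outsideCount W U (hittingTime W U k 1 ω) i ω := by
    rw [emptyCount, Finset.card_eq_zero, Finset.filter_eq_empty_iff]
    constructor
    · intro h i hi
      exact h (x := i + 1) (Finset.mem_Icc.2 ⟨by omega, hi⟩)
    · intro h j hj
      rw [Finset.mem_Icc] at hj
      have := h (j - 1) (by omega)
      rwa [Nat.sub_add_cancel hj.1] at this
  rw [h1]
  refine forall₂_congr fun i hi => ?_
  rw [outsideCount_ne_iff hR]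
  constructor
  · rintro ⟨b, hb, hbU⟩
    refine ⟨b + 1, by omega, ?_, by simpa using hbU⟩
    -- The last point lies beyond `R_k`, hence in none of the first `k` intervals, so the strict
    -- bound on `j` loses nothing.
    by_contra! hle
    rw [show hittingTime W U k 1 ω - 1 = b by omega] at hU
    exact absurd (hbU.2.trans_le (hR hi)) (not_lt.2 hU)
  · rintro ⟨j, hj1, hj, hjU⟩
    exact ⟨j - 1, by omega, hjU⟩

end Pathwise

/-! ### Measurability of the counts and hitting times. -/

section Measurability

variable {Ω : Type*} [MeasurableSpace Ω] {W U : ℕ → Ω → ℝ}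

theorem measurable_endpoint (hW : ∀ i, Measurable (W i)) (k : ℕ) : Measurable (endpoint W k) := by
  unfold endpoint stickLength
  fun_prop

theorem measurable_outsideCount (hW : ∀ i, Measurable (W i)) (hU : ∀ i, Measurable (U i))
    (n k : ℕ) : Measurable (outsideCount W U n k) := by
  classical
  induction n with
  | zero =>
    simp only [show outsideCount W U 0 k = fun _ => 0 from
      funext fun ω => outsideCount_zero_left W U k ω]
    exact measurable_const
  | succ n ih =>
    rw [show outsideCount W U (n + 1) k = fun ω => outsideCount W U n k ω
      + if endpoint W k ω ≤ U n ω then 1 else 0 from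
      funext fun ω => outsideCount_succ W U n k ω]
    exact ih.add (Measurable.ite (measurableSet_le (measurable_endpoint hW k) (hU n))
      measurable_const measurable_const)

theorem measurable_hittingTime (hW : ∀ i, Measurable (W i)) (hU : ∀ i, Measurable (U i))
    (k m : ℕ) : Measurable (hittingTime W U k m) := by
  have hS : ∀ n, MeasurableSet {ω | outsideCount W U n k ω = m} := fun n =>
    measurable_outsideCount hW hU n k (measurableSet_singleton m)
  refine measurable_of_Iic fun n => ?_
  -- The second set is the event that level `m` is never attained, where the infimum is `0` by
  -- convention.
  have : hittingTime W U k m ⁻¹' Set.Iic n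
      = (⋃ i ∈ Set.Iic n, {ω | outsideCount W U i k ω = m})
        ∪ ⋂ i, {ω | outsideCount W U i k ω = m}ᶜ := by
    ext ω
    simp only [Set.mem_preimage, Set.mem_Iic, Set.mem_union, Set.mem_iUnion, Set.mem_iInter,
      Set.mem_compl_iff, Set.mem_ofPred_eq, exists_prop]
    constructor
    · intro h
      by_cases hne : {n : ℕ | outsideCount W U n k ω = m}.Nonempty
      · exact Or.inl ⟨_, h, Nat.sInf_mem hne⟩
      · refine Or.inr fun i hi => hne ⟨i, hi⟩
    · rintro (⟨i, hi, h⟩ | h)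
      · have hle : hittingTime W U k m ω ≤ i := Nat.sInf_le h
        exact hle.trans hi
      · have : {n : ℕ | outsideCount W U n k ω = m} = ∅ := Set.eq_empty_of_forall_notMem h
        rw [hittingTime, this, Nat.sInf_empty]
        exact Nat.zero_le _
  rw [this]
  exact (MeasurableSet.biUnion (Set.to_countable _) fun i _ => hS i).union
    (MeasurableSet.iInter fun i => (hS i).compl)

theorem measurable_reversedCount (hW : ∀ i, Measurable (W i)) (hU : ∀ i, Measurable (U i))
    (ℓ K j : ℕ) : Measurable (reversedCount W U ℓ K j) := by
  refine measurable_to_countable' fun y => ?_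
  have : reversedCount W U ℓ K j ⁻¹' {y}
      = ⋃ n, hittingTime W U K ℓ ⁻¹' {n} ∩ outsideCount W U n (K - j) ⁻¹' {y} := by
    ext ω
    simp [reversedCount]
  rw [this]
  exact MeasurableSet.iUnion fun n =>
    (measurable_hittingTime hW hU K ℓ (measurableSet_singleton n)).inter
      (measurable_outsideCount hW hU n (K - j) (measurableSet_singleton y))

end Measurability

/-! ### Joint law of the counts for fixed levels. -/

section Counting

variable {Ω : Type*} [MeasurableSpace Ω] {μ : Measure Ω}

theorem uniform_real_Ici {r : ℝ} (h0 : 0 ≤ r) (h1 : r ≤ 1) :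
    ((volume : Measure ℝ).restrict (Set.Icc 0 1)).real (Set.Ici r) = 1 - r := by
  rw [measureReal_restrict_apply measurableSet_Ici]
  have : Set.Ici r ∩ Set.Icc 0 1 = Set.Icc r 1 := by
    ext x
    simp only [Set.mem_inter_iff, Set.mem_Ici, Set.mem_Icc]
    constructor
    · rintro ⟨a, b, c⟩; exact ⟨a, c⟩
    · rintro ⟨a, b⟩; exact ⟨a, h0.trans a, b⟩
  rw [this, Real.volume_real_Icc_of_le h1]

theorem uniform_real_Ico {r s : ℝ} (h0 : 0 ≤ r) (hrs : r ≤ s) (h1 : s ≤ 1) :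
    ((volume : Measure ℝ).restrict (Set.Icc 0 1)).real (Set.Ico r s) = s - r := by
  rw [measureReal_restrict_apply measurableSet_Ico, Set.inter_eq_left.2, Real.volume_real_Ico_of_le hrs]
  exact fun x hx => ⟨h0.trans hx.1, hx.2.le.trans h1⟩

theorem measureReal_forall_mem [IsProbabilityMeasure μ] {U : ℕ → Ω → ℝ}
    (hU : ∀ i, Measurable (U i)) (hind : iIndepFun U μ) (B : Finset ℕ) {V : ℕ → Set ℝ}
    (hV : ∀ b, MeasurableSet (V b)) :
    μ.real {ω | ∀ b ∈ B, U b ω ∈ V b} = ∏ b ∈ B, (μ.map (U b)).real (V b) := by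
  have h := hind.measure_inter_preimage_eq_mul B (sets := V) fun b _ => hV b
  have e : {ω | ∀ b ∈ B, U b ω ∈ V b} = ⋂ b ∈ B, U b ⁻¹' V b := by
    ext ω; simp
  rw [e, measureReal_def, h, ENNReal.toReal_prod]
  refine Finset.prod_congr rfl fun b _ => ?_
  rw [measureReal_def, Measure.map_apply (hU b) (hV b)]

open Classical in
/-- Joint law of the numbers of points beyond the levels `r j ≤ r (j + 1) ≤ ⋯ ≤ r K`, among points
indexed by `S` that are all beyond `r j`, with the point `a` beyond `r K`. -/
theorem measureReal_counts [IsProbabilityMeasure μ] {U : ℕ → Ω → ℝ}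
    (hU : ∀ i, Measurable (U i)) (hind : iIndepFun U μ)
    (hlaw : ∀ i, μ.map (U i) = (volume : Measure ℝ).restrict (Set.Icc 0 1))
    {r : ℕ → ℝ} (hr : Monotone r) (h0 : ∀ i, 0 ≤ r i) (h1 : ∀ i, r i ≤ 1) {y : ℕ → ℕ} {K : ℕ}
    (hy : ∀ i < K, y (i + 1) ≤ y i) (hy1 : 1 ≤ y K) {a : ℕ} (d : ℕ) :
    ∀ j, j + d = K → ∀ S : Finset ℕ, a ∈ S → S.card = y j →
      ∀ (B : Finset ℕ) (V : ℕ → Set ℝ), (∀ b, MeasurableSet (V b)) → Disjoint B S →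
      μ.real {ω | (∀ b ∈ B, U b ω ∈ V b) ∧ (∀ b ∈ S, r j ≤ U b ω) ∧
          (∀ i, j ≤ i → i ≤ K → (S.filter fun b => r i ≤ U b ω).card = y i) ∧ r K ≤ U a ω}
        = (∏ b ∈ B, (μ.map (U b)).real (V b)) *
          ((∏ i ∈ Finset.Ico j K, ((y i - 1).choose (y (i + 1) - 1) : ℝ)
            * (r (i + 1) - r i) ^ (y i - y (i + 1))) * (1 - r K) ^ y K) := by
  -- The induction peels off the lowest level. The pair `B`, `V` stores the points already located,
  -- so that independence is used only once, in the base case.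
  induction d with
  | zero =>
    intro j hj S ha hS B V hV hBS
    obtain rfl : j = K := by omega
    have e : {ω | (∀ b ∈ B, U b ω ∈ V b) ∧ (∀ b ∈ S, r j ≤ U b ω) ∧
          (∀ i, j ≤ i → i ≤ j → (S.filter fun b => r i ≤ U b ω).card = y i) ∧ r j ≤ U a ω}
        = {ω | ∀ b ∈ B ∪ S, U b ω ∈ if b ∈ B then V b else Set.Ici (r j)} := by
      ext ω
      simp only [Set.mem_ofPred_eq, Finset.mem_union]
      constructor
      · rintro ⟨hB, hS', -⟩ b hb
        split_ifs with hbB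
        · exact hB b hbB
        · exact hS' b (hb.resolve_left hbB)
      · intro h
        have hS' : ∀ b ∈ S, r j ≤ U b ω := fun b hb => by
          simpa [Finset.disjoint_right.1 hBS hb] using h b (Or.inr hb)
        refine ⟨fun b hb => by simpa [hb] using h b (Or.inl hb), hS', fun i hi hi' => ?_,
          hS' a ha⟩
        rw [le_antisymm hi' hi, Finset.filter_true_of_mem hS', hS]
    rw [e, measureReal_forall_mem hU hind _ (fun b => by
        split_ifs
        exacts [hV b, measurableSet_Ici]),
      Finset.prod_union hBS, Finset.Ico_self, Finset.prod_empty, one_mul, ← hS]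
    congr 1
    · exact Finset.prod_congr rfl fun b hb => by rw [if_pos hb]
    · rw [← Finset.prod_const]
      refine Finset.prod_congr rfl fun b hb => ?_
      rw [if_neg (Finset.disjoint_right.1 hBS hb), hlaw, uniform_real_Ici (h0 _) (h1 _)]
  | succ d ih =>
    intro j hj S ha hS B V hV hBS
    have hjK : j < K := by omega
    have hyj : ∀ i, i ≤ K → 1 ≤ y i := fun i hi => by
      obtain ⟨e, rfl⟩ := Nat.exists_eq_add_of_le hi
      clear ih hj hjK hS
      induction e with
      | zero => exact hy1
      | succ e ihe =>
        exact ihe (fun i hi => hy i (by omega)) (hy1.trans (hy (i + e) (by omega))) (by omega)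
    have hyj1 := hyj (j + 1) hjK
    -- Sum over the set `T` of points, apart from `a`, that lie beyond the next level. As `a` is
    -- forced to be there, the number of choices is a binomial coefficient with both entries lowered
    -- by one. The points of `S` outside `insert a T` lie in `[r j, r (j + 1))` and join `B`.
    let F : Finset (Finset ℕ) := (S.erase a).powersetCard (y (j + 1) - 1)
    let V' : Finset ℕ → ℕ → Set ℝ := fun T b => if b ∈ B then V b else Set.Ico (r j) (r (j + 1))
    let G : Finset ℕ → Set Ω := fun T => {ω | (∀ b ∈ B ∪ (S \ insert a T), U b ω ∈ V' T b) ∧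
      (∀ b ∈ insert a T, r (j + 1) ≤ U b ω) ∧
      (∀ i, j + 1 ≤ i → i ≤ K → ((insert a T).filter fun b => r i ≤ U b ω).card = y i) ∧
      r K ≤ U a ω}
    have hT : ∀ T ∈ F, a ∉ T ∧ insert a T ⊆ S ∧ (insert a T).card = y (j + 1) := fun T hT => by
      obtain ⟨hTs, hTc⟩ := Finset.mem_powersetCard.1 hT
      have haT : a ∉ T := fun h => (Finset.mem_erase.1 (hTs h)).1 rfl
      refine ⟨haT, Finset.insert_subset ha (hTs.trans (Finset.erase_subset _ _)), ?_⟩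
      rw [Finset.card_insert_of_notMem haT, hTc, Nat.sub_add_cancel hyj1]
    have hV' : ∀ T b, MeasurableSet (V' T b) := fun T b => by
      simp only [V']
      split_ifs
      exacts [hV b, measurableSet_Ico]
    -- The sample determines `T`, which makes the events `G T` disjoint.
    have hfil : ∀ T ∈ F, ∀ ω ∈ G T, (S.filter fun b => r (j + 1) ≤ U b ω) = insert a T := by
      intro T hTF ω hω
      ext b
      rw [Finset.mem_filter]
      constructor
      · rintro ⟨hbS, hb⟩
        by_contra hbT
        have := hω.1 b (Finset.mem_union_right _ (Finset.mem_sdiff.2 ⟨hbS, hbT⟩))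
        simp only [V', if_neg (Finset.disjoint_right.1 hBS hbS)] at this
        exact absurd this.2 (not_lt.2 hb)
      · exact fun hb => ⟨(hT T hTF).2.1 hb, hω.2.1 b hb⟩
    have hunion : {ω | (∀ b ∈ B, U b ω ∈ V b) ∧ (∀ b ∈ S, r j ≤ U b ω) ∧
          (∀ i, j ≤ i → i ≤ K → (S.filter fun b => r i ≤ U b ω).card = y i) ∧ r K ≤ U a ω}
        = ⋃ T ∈ F, G T := by
      ext ω
      simp only [Set.mem_ofPred_eq, Set.mem_iUnion, exists_prop]
      constructor
      · rintro ⟨hB, hS', hc, haK⟩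
        have hmem : a ∈ S.filter fun b => r (j + 1) ≤ U b ω :=
          Finset.mem_filter.2 ⟨ha, (hr hjK).trans haK⟩
        refine ⟨(S.filter fun b => r (j + 1) ≤ U b ω).erase a, Finset.mem_powersetCard.2
          ⟨Finset.erase_subset_erase _ (Finset.filter_subset _ _), ?_⟩, ?_⟩
        · rw [Finset.card_erase_of_mem hmem, hc _ (Nat.le_succ j) hjK]
        · simp only [G, Finset.insert_erase hmem]
          refine ⟨fun b hb => ?_, fun b hb => (Finset.mem_filter.1 hb).2, fun i hi hiK => ?_, haK⟩
          · simp only [V']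
            split_ifs with hbB
            · exact hB b hbB
            · obtain ⟨hbS, hbT⟩ := Finset.mem_sdiff.1 ((Finset.mem_union.1 hb).resolve_left hbB)
              refine ⟨hS' b hbS, ?_⟩
              by_contra! hle
              exact hbT (Finset.mem_filter.2 ⟨hbS, hle⟩)
          · rw [Finset.filter_filter, ← hc i (by omega) hiK]
            congr 1
            exact Finset.filter_congr fun b _ => ⟨fun h => h.2, fun h => ⟨(hr hi).trans h, h⟩⟩
      · rintro ⟨T, hTF, hω⟩
        have hfil' := hfil T hTF ω hω
        obtain ⟨hB, hT', hc, haK⟩ := hω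
        have hS' : ∀ b ∈ S, r j ≤ U b ω := fun b hb => by
          by_cases hbT : b ∈ insert a T
          · exact (hr (Nat.le_succ j)).trans (hT' b hbT)
          · have := hB b (Finset.mem_union_right _ (Finset.mem_sdiff.2 ⟨hb, hbT⟩))
            simp only [V', if_neg (Finset.disjoint_right.1 hBS hb)] at this
            exact this.1
        refine ⟨fun b hb => ?_, hS', fun i hi hiK => ?_, haK⟩
        · have := hB b (Finset.mem_union_left _ hb)
          simpa only [V', if_pos hb] using this
        · rcases hi.eq_or_lt with rfl | hlt
          · rw [Finset.filter_true_of_mem hS', hS]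
          · rw [← hc i hlt hiK, ← hfil', Finset.filter_filter]
            congr 1
            exact Finset.filter_congr fun b _ => ⟨fun h => ⟨(hr hlt).trans h, h⟩, fun h => h.2⟩
    have hmeas : ∀ T ∈ F, MeasurableSet (G T) := fun T hTF => by
      have hle : ∀ c b, MeasurableSet {ω | c ≤ U b ω} := fun c b =>
        measurableSet_le measurable_const (hU b)
      have hcard : ∀ i, Measurable fun ω => ((insert a T).filter fun b => r i ≤ U b ω).card := by
        intro i
        simp only [Finset.card_filter]
        exact Finset.measurable_sum _ fun b _ =>
          Measurable.ite (hle _ _) measurable_const measurable_const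
      have e : G T = (⋂ b ∈ B ∪ (S \ insert a T), U b ⁻¹' V' T b)
          ∩ ((⋂ b ∈ insert a T, {ω | r (j + 1) ≤ U b ω})
          ∩ ((⋂ i : ℕ, ⋂ _ : j + 1 ≤ i, ⋂ _ : i ≤ K,
              (fun ω => ((insert a T).filter fun b => r i ≤ U b ω).card) ⁻¹' {y i})
          ∩ {ω | r K ≤ U a ω})) := by
        ext ω
        simp only [G, Set.mem_inter_iff, Set.mem_iInter, Set.mem_preimage,
          Set.mem_singleton_iff, Set.mem_ofPred_eq]
      rw [e]
      exact (Finset.measurableSet_biInter _ fun b _ => hU b (hV' T b)).inter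
        ((Finset.measurableSet_biInter _ fun b _ => hle _ b).inter
        ((MeasurableSet.iInter fun i => MeasurableSet.iInter fun _ =>
          MeasurableSet.iInter fun _ => hcard i (measurableSet_singleton (y i))).inter (hle _ _)))
    have hdisj : (F : Set (Finset ℕ)).PairwiseDisjoint G := by
      intro T hTF T' hTF' hne
      refine Set.disjoint_left.2 fun ω h h' => hne ?_
      have := (hfil T hTF ω h).symm.trans (hfil T' hTF' ω h')
      rw [← Finset.erase_insert (hT T hTF).1, this, Finset.erase_insert (hT T' hTF').1]
    rw [hunion, measureReal_biUnion_finset hdisj hmeas]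
    have hterm : ∀ T ∈ F, μ.real (G T) = (∏ b ∈ B, (μ.map (U b)).real (V b)) *
        (r (j + 1) - r j) ^ (y j - y (j + 1)) *
          ((∏ i ∈ Finset.Ico (j + 1) K, ((y i - 1).choose (y (i + 1) - 1) : ℝ)
            * (r (i + 1) - r i) ^ (y i - y (i + 1))) * (1 - r K) ^ y K) := fun T hTF => by
      obtain ⟨haT, hsub, hcard⟩ := hT T hTF
      have hd : Disjoint B (S \ insert a T) := hBS.mono_right Finset.sdiff_subset
      rw [ih (j + 1) (by omega) (insert a T) (Finset.mem_insert_self _ _) hcard _ (V' T) (hV' T)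
        (Finset.disjoint_union_left.2 ⟨hBS.mono_right hsub, Finset.sdiff_disjoint⟩),
        Finset.prod_union hd]
      congr 2
      · exact Finset.prod_congr rfl fun b hb => by simp only [V', if_pos hb]
      · rw [← hS, ← hcard, ← Finset.card_sdiff_of_subset hsub, ← Finset.prod_const]
        refine Finset.prod_congr rfl fun b hb => ?_
        simp only [V', if_neg (Finset.disjoint_right.1 hd hb)]
        rw [hlaw, uniform_real_Ico (h0 _) (hr (Nat.le_succ j)) (h1 _)]
    rw [Finset.sum_congr rfl hterm, Finset.sum_const, Finset.card_powersetCard,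
      Finset.card_erase_of_mem ha, hS, Finset.prod_eq_prod_Ico_succ_bot hjK, nsmul_eq_mul]
    ring

end Counting

/-! ### The reversed counts form the chain. -/

section Model

variable {Ω : Type*} [MeasurableSpace Ω] {μ : Measure Ω}

/-- Conditioning on one of two independent variables. -/
theorem measureReal_pair_eq_integral {α β : Type*} [MeasurableSpace α] [MeasurableSpace β]
    [IsProbabilityMeasure μ] {A : Ω → α} {B : Ω → β} (hA : Measurable A) (hB : Measurable B)
    (h : IndepFun A B μ) {E : Set (α × β)} (hE : MeasurableSet E) :
    μ.real {ω | (A ω, B ω) ∈ E} = ∫ ω', μ.real {ω | (A ω', B ω) ∈ E} ∂μ := by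
  have hm : Measurable fun a => μ.map B (Prod.mk a ⁻¹' E) := by
    have := Measure.isProbabilityMeasure_map (μ := μ) hB.aemeasurable
    exact measurable_measure_prodMk_left hE
  have e : ∀ a, μ.map B (Prod.mk a ⁻¹' E) = μ {ω | (a, B ω) ∈ E} := fun a =>
    Measure.map_apply hB (measurable_prodMk_left hE)
  have h1 : μ {ω | (A ω, B ω) ∈ E} = ∫⁻ ω', μ {ω | (A ω', B ω) ∈ E} ∂μ := by
    have := Measure.isProbabilityMeasure_map (μ := μ) hB.aemeasurable
    have h2 := h.map_prod_eq_prod_map_map hA.aemeasurable hB.aemeasurable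
    have h3 := congrArg (fun ρ => ρ E) h2
    simp only [Measure.map_apply (hA.prodMk hB) hE, Measure.prod_apply hE] at h3
    rw [lintegral_map hm hA] at h3
    simp only [e] at h3
    exact h3
  have hm' : Measurable fun ω' => μ {ω | (A ω', B ω) ∈ E} := by
    simp only [← e]
    exact hm.comp hA
  simp only [measureReal_def]
  rw [h1, integral_toReal hm'.aemeasurable (ae_of_all _ fun ω => measure_lt_top _ _)]

/-- The factor `1 - w i` occurs in every later stick and in the remainder. Its exponents telescope
to `y (i + 1)`. -/
theorem prod_stickLength_pow (w : ℕ → ℝ) {y : ℕ → ℕ} {K : ℕ} (hy : ∀ i < K, y (i + 1) ≤ y i) :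
    (∏ i ∈ Finset.range K, ((∏ j ∈ Finset.range i, (1 - w j)) * w i) ^ (y i - y (i + 1)))
        * (∏ j ∈ Finset.range K, (1 - w j)) ^ y K
      = ∏ i ∈ Finset.range K, (w i ^ (y i - y (i + 1)) * (1 - w i) ^ y (i + 1)) := by
  induction K with
  | zero => simp
  | succ K ih =>
    have hK := hy K (Nat.lt_succ_self K)
    rw [Finset.prod_range_succ _ K, Finset.prod_range_succ _ K, Finset.prod_range_succ _ K,
      ← ih fun i hi => hy i (by omega), mul_pow, mul_pow]
    have e : (∏ j ∈ Finset.range K, (1 - w j)) ^ y K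
        = (∏ j ∈ Finset.range K, (1 - w j)) ^ (y K - y (K + 1))
          * (∏ j ∈ Finset.range K, (1 - w j)) ^ y (K + 1) := by
      rw [← pow_add, Nat.sub_add_cancel hK]
    rw [e]
    ring

variable {ν : Measure ℝ} {W U : ℕ → Ω → ℝ}

theorem IsModel.ae_factor_mem (h : IsModel ν μ W U) (hν : ∀ᵐ x ∂ν, x ∈ Set.Ioo (0 : ℝ) 1) :
    ∀ᵐ ω ∂μ, ∀ i, W i ω ∈ Set.Ioo (0 : ℝ) 1 := by
  rw [ae_all_iff]
  intro i
  rw [← h.law_factor i] at hν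
  exact ae_of_ae_map (h.measurable_factor i).aemeasurable hν

theorem IsModel.ae_point_nonneg (h : IsModel ν μ W U) : ∀ᵐ ω ∂μ, ∀ i, 0 ≤ U i ω := by
  rw [ae_all_iff]
  intro i
  have : ∀ᵐ x ∂μ.map (U i), 0 ≤ x := by
    rw [h.law_point i]
    exact ae_restrict_of_forall_mem measurableSet_Icc fun x hx => hx.1
  exact ae_of_ae_map (h.measurable_point i).aemeasurable this

/-- Given the factors `W_i` the levels are deterministic, so the counting formula applies. After
regrouping, independence of the `W_i` makes the expectation factor into transition probabilities. -/
theorem IsModel.measureReal_outsideCount [IsProbabilityMeasure μ] (h : IsModel ν μ W U)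
    (hν : ∀ᵐ x ∂ν, x ∈ Set.Ioo (0 : ℝ) 1) {y : ℕ → ℕ} {K : ℕ}
    (hy : ∀ i < K, y (i + 1) ≤ y i) (hy1 : 1 ≤ y K) (hy0 : 1 ≤ y 0) :
    μ.real {ω | (∀ i ≤ K, outsideCount W U (y 0) i ω = y i) ∧ endpoint W K ω ≤ U (y 0 - 1) ω}
      = ∏ i ∈ Finset.range K, transitionProb ν (y (i + 1)) (y i) := by
  classical
  -- Coordinates on the space of pairs of sequences express the event as a measurable set in the
  -- values of `(W, U)`, as conditioning on `W` requires.
  let W' : ℕ → (ℕ → ℝ) × (ℕ → ℝ) → ℝ := fun i p => p.1 i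
  let U' : ℕ → (ℕ → ℝ) × (ℕ → ℝ) → ℝ := fun i p => p.2 i
  have hW' : ∀ i, Measurable (W' i) := fun i => (measurable_pi_apply i).comp measurable_fst
  have hU' : ∀ i, Measurable (U' i) := fun i => (measurable_pi_apply i).comp measurable_snd
  let E : Set ((ℕ → ℝ) × (ℕ → ℝ)) := (⋂ i ∈ Set.Iic K, outsideCount W' U' (y 0) i ⁻¹' {y i})
    ∩ {p | endpoint W' K p ≤ U' (y 0 - 1) p}
  have hE : MeasurableSet E := (MeasurableSet.biInter (Set.to_countable _) fun i _ =>
    measurable_outsideCount hW' hU' (y 0) i (measurableSet_singleton (y i))).inter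
      (measurableSet_le (measurable_endpoint hW' K) (hU' _))
  have hmemE : ∀ ω' ω, ((fun i => W i ω'), fun i => U i ω) ∈ E ↔
      (∀ i ≤ K, ((Finset.range (y 0)).filter fun b => endpoint W i ω' ≤ U b ω).card = y i)
        ∧ endpoint W K ω' ≤ U (y 0 - 1) ω := fun ω' ω => by
    simp only [E, Set.mem_inter_iff, Set.mem_iInter, Set.mem_Iic, Set.mem_preimage,
      Set.mem_singleton_iff, Set.mem_ofPred_eq]
    unfold outsideCount
    refine and_congr (forall₂_congr fun i _ => ?_) Iff.rfl
    rw [Finset.card_filter, Finset.card_filter]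
    rfl
  have h1 := measureReal_pair_eq_integral (measurable_pi_lambda _ h.measurable_factor)
    (measurable_pi_lambda _ h.measurable_point) h.indep hE
  have e1 : {ω | (∀ i ≤ K, outsideCount W U (y 0) i ω = y i) ∧ endpoint W K ω ≤ U (y 0 - 1) ω}
      = {ω | ((fun i => W i ω), fun i => U i ω) ∈ E} := by
    ext ω
    simp only [Set.mem_ofPred_eq, hmemE]
    unfold outsideCount
    refine and_congr (forall₂_congr fun i _ => ?_) Iff.rfl
    rw [Finset.card_filter]
  rw [e1, h1]
  have h2 : ∀ᵐ ω' ∂μ, μ.real {ω | ((fun i => W i ω'), fun i => U i ω) ∈ E}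
      = ∏ i ∈ Finset.range K, (((y i - 1).choose (y (i + 1) - 1) : ℝ)
        * (W i ω' ^ (y i - y (i + 1)) * (1 - W i ω') ^ y (i + 1))) := by
    filter_upwards [h.ae_factor_mem hν] with ω' hω'
    have h3 := measureReal_counts h.measurable_point h.indep_point h.law_point
      (monotone_endpoint hω') (endpoint_nonneg hω') (endpoint_le_one hω') hy hy1 (a := y 0 - 1) K
      0 (zero_add K) (Finset.range (y 0)) (Finset.mem_range.2 (by omega)) (Finset.card_range _) ∅
      (fun _ => ∅) (fun _ => MeasurableSet.empty) (Finset.disjoint_empty_left _)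
    have h4 : ({ω | ((fun i => W i ω'), fun i => U i ω) ∈ E} : Set Ω) =ᵐ[μ]
        {ω | (∀ b ∈ (∅ : Finset ℕ), U b ω ∈ (∅ : Set ℝ)) ∧
          (∀ b ∈ Finset.range (y 0), endpoint W 0 ω' ≤ U b ω) ∧
          (∀ i, 0 ≤ i → i ≤ K → ((Finset.range (y 0)).filter
            fun b => endpoint W i ω' ≤ U b ω).card = y i) ∧ endpoint W K ω' ≤ U (y 0 - 1) ω} := by
      filter_upwards [h.ae_point_nonneg] with ω hω
      refine propext ((hmemE ω' ω).trans ?_)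
      constructor
      · rintro ⟨ha, hb⟩
        refine ⟨fun b hb => absurd hb (Finset.notMem_empty b), fun b _ => ?_,
          fun i _ hi => ha i hi, hb⟩
        rw [endpoint_zero]
        exact hω b
      · rintro ⟨-, -, ha, hb⟩
        exact ⟨fun i hi => ha i (Nat.zero_le i) hi, hb⟩
    rw [measureReal_congr h4]
    refine Eq.trans (by convert h3) ?_
    rw [Finset.prod_empty, one_mul, ← Finset.range_eq_Ico, Finset.prod_mul_distrib,
      Finset.prod_mul_distrib, mul_assoc, ← prod_stickLength_pow (fun i => W i ω') hy,
      one_sub_endpoint]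
    congr 3
    refine funext fun i => ?_
    rw [endpoint_succ, add_sub_cancel_left, stickLength]
  rw [integral_congr_ae h2]
  have hind : iIndepFun (fun i : Fin K => W i) μ := h.indep_factor.precomp Fin.val_injective
  have h5 := hind.integral_fun_prod_comp (𝕜 := ℝ) (X := fun i : Fin K => W i)
    (f := fun i w => ((y i - 1).choose (y (i + 1) - 1) : ℝ)
        * (w ^ (y i - y (i + 1)) * (1 - w) ^ y (i + 1)))
    (fun i => (h.measurable_factor i).aemeasurable) (fun i => by fun_prop)
  simp only [Finset.prod_range]
  rw [h5]
  refine Finset.prod_congr rfl fun i _ => ?_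
  rw [integral_const_mul, transitionProb, if_pos (hy i i.2), ← h.law_factor i,
    integral_map (h.measurable_factor i).aemeasurable (by fun_prop)]

theorem prod_transitionProb_eq_zero {ν : Measure ℝ} {x : ℕ → ℕ} {k j : ℕ} (hj : j < k)
    (h : x (j + 1) < x j) :
    ∏ j ∈ Finset.range k, transitionProb ν (x j) (x (j + 1)) = 0 :=
  Finset.prod_eq_zero (Finset.mem_range.2 hj) (transitionProb_eq_zero ν h)

theorem IsModel.measureReal_reversedCount [IsProbabilityMeasure μ] (h : IsModel ν μ W U)
    (hν : ∀ᵐ x ∂ν, x ∈ Set.Ioo (0 : ℝ) 1) {ℓ : ℕ} (hℓ : 1 ≤ ℓ) (K : ℕ) {x : ℕ → ℕ}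
    (hx : x 0 = ℓ) :
    μ.real {ω | ∀ j ≤ K, reversedCount W U ℓ K j ω = x j}
      = ∏ j ∈ Finset.range K, transitionProb ν (x j) (x (j + 1)) := by
  by_cases hmono : ∀ j < K, x j ≤ x (j + 1)
  · have hle : ∀ j ≤ K, 1 ≤ x j := fun j => by
      induction j with
      | zero => exact fun _ => hx ▸ hℓ
      | succ j ih => exact fun hj => (ih (by omega)).trans (hmono j hj)
    have hmain := h.measureReal_outsideCount hν (y := fun i => x (K - i)) (K := K)
      (fun i hi => by
        have := hmono (K - (i + 1)) (by omega)
        rwa [show K - (i + 1) + 1 = K - i by omega] at this)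
      (hle _ (by omega)) (hle _ (by omega))
    have hR : ∏ i ∈ Finset.range K, transitionProb ν (x (K - (i + 1))) (x (K - i))
        = ∏ j ∈ Finset.range K, transitionProb ν (x j) (x (j + 1)) := by
      rw [← Finset.prod_range_reflect]
      refine Finset.prod_congr rfl fun j hj => ?_
      rw [Finset.mem_range] at hj
      rw [show K - (K - 1 - j + 1) = j by omega, show K - (K - 1 - j) = j + 1 by omega]
    rw [← hR, ← hmain]
    refine measureReal_congr ?_
    filter_upwards [h.ae_point_nonneg] with ω hω
    refine propext ?_
    simp only [Nat.sub_zero]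
    constructor
    · intro (hj : ∀ j ≤ K, reversedCount W U ℓ K j ω = x j)
      -- No point lies outside `[0, 1]` on the left, so the count outside zero intervals is the
      -- number of points: the last state of the path is the hitting time itself.
      have hN : hittingTime W U K ℓ ω = x K := by
        have := hj K le_rfl
        rwa [reversedCount, Nat.sub_self, outsideCount_zero_right hω] at this
      have hc : ∀ i ≤ K, outsideCount W U (x K) i ω = x (K - i) := fun i hi => by
        have := hj (K - i) (by omega)
        rwa [reversedCount, hN, Nat.sub_sub_self hi] at this
      refine ⟨hc, ((hittingTime_eq_iff hℓ K (x K)).1 ⟨hN, ?_⟩).2.2⟩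
      rw [hc K le_rfl, Nat.sub_self, hx]
    · rintro ⟨hc, hU⟩
      have hN := ((hittingTime_eq_iff (W := W) (U := U) (ω := ω) hℓ K (x K)).2
        ⟨hle K le_rfl, by rw [hc K le_rfl, Nat.sub_self, hx], hU⟩).1
      intro j hj
      rw [reversedCount, hN, hc _ (by omega), Nat.sub_sub_self hj]
  -- A path with a downward step has probability zero on both sides, because the counts are nested.
  · push Not at hmono
    obtain ⟨j, hj, hlt⟩ := hmono
    rw [prod_transitionProb_eq_zero hj hlt, measureReal_def, measure_eq_zero_iff_ae_notMem.2,
      ENNReal.toReal_zero]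
    filter_upwards [h.ae_factor_mem hν] with ω hω hω'
    have h1 := hω' j hj.le
    have h2 := hω' (j + 1) hj
    have h3 : reversedCount W U ℓ K j ω ≤ reversedCount W U ℓ K (j + 1) ω := by
      rw [reversedCount, reversedCount, outsideCount, outsideCount]
      exact Finset.card_le_card (Finset.monotone_filter_right _ fun b _ hb =>
        (monotone_endpoint hω (show K - (j + 1) ≤ K - j by omega)).trans hb)
    omega

/-- Summing out the last state, with row sums equal to one, shortens the known law of full paths
step by step. -/
theorem measureReal_marginal {q : ℕ → ℕ → ℝ} {ℓ K : ℕ} (hℓ : 1 ≤ ℓ)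
    (hq0 : ∀ m n, n < m → q m n = 0) (hq : ∀ m, 1 ≤ m → HasSum (q m) 1) [IsProbabilityMeasure μ]
    {Y : ℕ → Ω → ℕ} (hY : ∀ j, Measurable (Y j))
    (h : ∀ x : ℕ → ℕ, x 0 = ℓ → μ.real {ω | ∀ j ≤ K, Y j ω = x j}
      = ∏ j ∈ Finset.range K, q (x j) (x (j + 1))) (d : ℕ) :
    ∀ k, k + d = K → ∀ x : ℕ → ℕ, x 0 = ℓ → μ.real {ω | ∀ j ≤ k, Y j ω = x j}
      = ∏ j ∈ Finset.range k, q (x j) (x (j + 1)) := by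
  induction d with
  | zero => rintro k rfl; exact h
  | succ d ih =>
    intro k hk x hx
    have hA : MeasurableSet {ω | ∀ j ≤ k, Y j ω = x j} := by
      have : {ω | ∀ j ≤ k, Y j ω = x j} = ⋂ j ∈ Set.Iic k, Y j ⁻¹' {x j} := by
        ext ω; simp
      rw [this]
      exact MeasurableSet.biInter (Set.to_countable _) fun j _ =>
        hY j (measurableSet_singleton (x j))
    have h1 := hasSum_integral_fiber (μ := μ.restrict {ω | ∀ j ≤ k, Y j ω = x j}) (hY (k + 1))
      (integrable_const (1 : ℝ))
    have h2 : ∀ n, ∫ _ in Y (k + 1) ⁻¹' {n}, (1 : ℝ) ∂μ.restrict {ω | ∀ j ≤ k, Y j ω = x j}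
        = (∏ j ∈ Finset.range k, q (x j) (x (j + 1))) * q (x k) n := fun n => by
      rw [Measure.restrict_restrict (hY (k + 1) (measurableSet_singleton n)), setIntegral_const,
        smul_eq_mul, mul_one]
      have h3 := ih (k + 1) (by omega) (fun j => if j ≤ k then x j else n) (by simpa using hx)
      have e : Y (k + 1) ⁻¹' {n} ∩ {ω | ∀ j ≤ k, Y j ω = x j}
          = {ω | ∀ j ≤ k + 1, Y j ω = if j ≤ k then x j else n} := by
        ext ω
        simp only [Set.mem_inter_iff, Set.mem_preimage, Set.mem_singleton_iff, Set.mem_ofPred_eq]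
        constructor
        · rintro ⟨ha, hb⟩ j hj
          split_ifs with hjk
          · exact hb j hjk
          · rw [show j = k + 1 by omega, ha]
        · intro hj
          refine ⟨by simpa using hj (k + 1) le_rfl, fun j hjk => ?_⟩
          simpa [hjk] using hj j (by omega)
      rw [e, h3, Finset.prod_range_succ]
      simp only [le_refl, if_true, Nat.not_succ_le_self, if_false]
      congr 1
      refine Finset.prod_congr rfl fun j hj => ?_
      rw [Finset.mem_range] at hj
      rw [if_pos hj.le, if_pos (by omega)]
    rw [setIntegral_const, smul_eq_mul, mul_one] at h1
    simp only [h2] at h1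
    refine h1.unique ?_
    by_cases h0 : ∏ j ∈ Finset.range k, q (x j) (x (j + 1)) = 0
    · simp [h0, hasSum_zero]
    · have hle : ∀ j ≤ k, 1 ≤ x j := fun j => by
        induction j with
        | zero => exact fun _ => hx ▸ hℓ
        | succ j ihj =>
          intro hj
          refine (ihj (by omega)).trans ?_
          by_contra! hlt
          exact Finset.prod_ne_zero_iff.1 h0 j (Finset.mem_range.2 hj) (hq0 _ _ hlt)
      simpa using (hq _ (hle k le_rfl)).mul_left (∏ j ∈ Finset.range k, q (x j) (x (j + 1)))

/-- The marginal at time `0` gives the state `ℓ` full mass, so all other initial states are null.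
For the reversed counts this also shows that the hitting time is almost surely attained, with no
separate argument. -/
theorem isChainUpTo_of_law {q : ℕ → ℕ → ℝ} {ℓ K : ℕ} (hℓ : 1 ≤ ℓ)
    (hq0 : ∀ m n, n < m → q m n = 0) (hq : ∀ m, 1 ≤ m → HasSum (q m) 1) [IsProbabilityMeasure μ]
    {Y : ℕ → Ω → ℕ} (hY : ∀ j, Measurable (Y j))
    (h : ∀ x : ℕ → ℕ, x 0 = ℓ → μ.real {ω | ∀ j ≤ K, Y j ω = x j}
      = ∏ j ∈ Finset.range K, q (x j) (x (j + 1))) : IsChainUpTo q ℓ K μ Y := by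
  have hm := measureReal_marginal hℓ hq0 hq hY h
  refine ⟨hY, fun k hk x => ?_⟩
  split_ifs with hx
  · exact hm (K - k) k (by omega) x hx
  · have h0 := hm K 0 (by omega) (fun _ => ℓ) rfl
    have e : {ω | ∀ j ≤ 0, Y j ω = ℓ} = Y 0 ⁻¹' {ℓ} := by
      ext ω; simp
    rw [Finset.range_zero, Finset.prod_empty, e] at h0
    have hc : μ.real (Y 0 ⁻¹' {ℓ})ᶜ = 0 := by
      rw [probReal_compl_eq_one_sub (hY 0 (measurableSet_singleton ℓ)), h0, sub_self]
    refine le_antisymm (le_trans (measureReal_mono ?_) hc.le) measureReal_nonneg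
    intro ω (hω : ∀ j ≤ k, Y j ω = x j) (hω' : Y 0 ω = ℓ)
    exact hx ((hω 0 (Nat.zero_le k)).symm.trans hω')

theorem IsModel.isChainUpTo [IsProbabilityMeasure μ] {θ : ℝ} (hθ : 0 < θ)
    (h : IsModel (betaMeasure 1 θ) μ W U) {ℓ : ℕ} (hℓ : 1 ≤ ℓ) (K : ℕ) :
    IsChainUpTo (transitionProb (betaMeasure 1 θ)) ℓ K μ (reversedCount W U ℓ K) :=
  isChainUpTo_of_law hℓ (fun _ _ => transitionProb_eq_zero _)
    (fun _ hm => hasSum_transitionProb_beta hθ hm)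
    (measurable_reversedCount h.measurable_factor h.measurable_point ℓ K)
    (fun _ hx => h.measureReal_reversedCount (ae_betaMeasure_mem_Ioo 1 θ) hℓ K hx)

theorem IsModel.map_emptyCount [IsProbabilityMeasure μ] {θ : ℝ} (hθ : 0 < θ)
    (h : IsModel (betaMeasure 1 θ) μ W U) {ℓ : ℕ} (hℓ : 1 ≤ ℓ) {Ω' : Type*} [MeasurableSpace Ω']
    {μ' : Measure Ω'} [IsProbabilityMeasure μ'] {Q : ℕ → Ω' → ℕ}
    (hQ : ∀ K, IsChainUpTo (transitionProb (betaMeasure 1 θ)) ℓ K μ' Q) (k : ℕ) :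
    μ.map (emptyCount W U ℓ k) = μ'.map (stayCount Q k) := by
  rw [show emptyCount W U ℓ k = stayCount (reversedCount W U ℓ k) k from
    funext fun ω => emptyCount_eq_stayCount W U ℓ k ω]
  exact (h.isChainUpTo hθ hℓ k).map_stayCount_eq (hQ k)

theorem IsModel.renewalProb_eq [IsProbabilityMeasure μ] {θ : ℝ} (hθ : 0 < θ)
    (h : IsModel (betaMeasure 1 θ) μ W U) (k : ℕ) :
    renewalProb μ W U k = μ.real {ω | stayCount (reversedCount W U 1 k) k ω = 0} := by
  refine measureReal_congr ?_
  filter_upwards [h.ae_factor_mem (ae_betaMeasure_mem_Ioo 1 θ),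
    (h.isChainUpTo hθ le_rfl k).ae_path (fun _ _ => transitionProb_eq_zero _)] with ω hω hω'
  refine propext ?_
  change (∀ i < k, _) ↔ stayCount (reversedCount W U 1 k) k ω = 0
  rw [← emptyCount_eq_stayCount]
  exact (emptyCount_eq_zero_iff (monotone_endpoint hω) hω'.1).symm

end Model

end StickBreaking

theorem mainTheorem4 (θ : ℝ) (hθ : 0 < θ) (ℓ : ℕ) (hℓ : 1 ≤ ℓ)
    {Ω : Type*} [MeasurableSpace Ω] (μ : Measure Ω) [IsProbabilityMeasure μ]
    (W U : ℕ → Ω → ℝ) (hWU : IsModel (betaMeasure 1 θ) μ W U)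
    {Ω' : Type*} [MeasurableSpace Ω'] (μ' : Measure Ω') [IsProbabilityMeasure μ']
    (Q : ℕ → Ω' → ℕ) (hQ : IsMarkovChainFrom (transitionProb (betaMeasure 1 θ)) ℓ μ' Q) :
    (∀ k : ℕ, μ.map (emptyCount W U ℓ k) = μ'.map (stayCount Q k)) ∧
    (∃ Cinf : Ω' → ℕ, Measurable Cinf ∧
      (∀ᵐ ω ∂μ', Monotone (fun k => stayCount Q k ω) ∧
        Tendsto (fun k => stayCount Q k ω) atTop (𝓝 (Cinf ω))) ∧
      (∀ p : ℝ, 0 < p →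
        Integrable (fun ω => (Cinf ω : ℝ) ^ p) μ' ∧
        Tendsto (fun k => ∫ ω, (emptyCount W U ℓ k ω : ℝ) ^ p ∂μ) atTop
          (𝓝 (∫ ω, (Cinf ω : ℝ) ^ p ∂μ')) ∧
        Tendsto (fun k => ∫ ω, (stayCount Q k ω : ℝ) ^ p ∂μ') atTop
          (𝓝 (∫ ω, (Cinf ω : ℝ) ^ p ∂μ'))) ∧
      (∀ z : ℂ, ‖z‖ < 1 + ℓ / θ →
        Integrable (fun ω => z ^ Cinf ω) μ' ∧
        ∫ ω, z ^ Cinf ω ∂μ' =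
          Complex.Gamma (ℓ + 1 + θ) * Complex.Gamma (ℓ + θ - θ * z)
            / (Complex.Gamma ℓ * Complex.Gamma (ℓ + 1 + 2 * θ - θ * z))) ∧
      μ'.map Cinf =
        mixedPoisson ((betaMeasure ℓ (θ + 1)).map fun h => (-θ * Real.log h).toNNReal)) ∧
    Tendsto (renewalProb μ W U) atTop
      (𝓝 (Real.Gamma (θ + 2) * Real.Gamma (θ + 1) / Real.Gamma (2 * θ + 2))) := by
  have hY := hQ.isChainUpTo
  have hlaw := hWU.map_emptyCount hθ hℓ hY
  refine ⟨hlaw, ⟨totalStays Q, measurable_totalStays hQ.measurable, ?_, fun p hp => ?_,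
    fun z hz => integrable_and_integral_pow_totalStays hθ hℓ hY hz, map_totalStays hθ hℓ hY⟩, ?_⟩
  · filter_upwards [ae_bddAbove_stayCount hθ hℓ hY] with ω hω
    exact ⟨monotone_stayCount Q ω, tendsto_stayCount_totalStays hω⟩
  · have ht := tendsto_integral_rpow_stayCount hθ hℓ hY hp
    refine ⟨integrable_rpow_totalStays hθ hℓ hY hp, ht.congr fun k => ?_, ht⟩
    have hm : Measurable (emptyCount W U ℓ k) := by
      rw [show emptyCount W U ℓ k = stayCount (reversedCount W U ℓ k) k from
        funext fun ω => emptyCount_eq_stayCount W U ℓ k ω]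
      exact measurable_stayCount (hWU.isChainUpTo hθ hℓ k).measurable k
    -- The moments on the two probability spaces agree because the laws do.
    rw [← integral_map (φ := stayCount Q k) (f := fun n : ℕ => (n : ℝ) ^ p)
      (measurable_stayCount hQ.measurable k).aemeasurable .of_discrete, ← hlaw k,
      integral_map hm.aemeasurable .of_discrete]
  · rw [show renewalProb μ W U = fun k => μ.real {ω | stayCount (reversedCount W U 1 k) k ω = 0}
      from funext fun k => hWU.renewalProb_eq hθ k]
    exact tendsto_measureReal_stayCount_eq_zero hθ fun k => hWU.isChainUpTo hθ le_rfl k
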